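/- For every integer $d>1$ there exist a finite alphabet $\mathcal{A}$ and a minimal subshift $(X,\sigma)$, $X\subset\mathcal{A}^{\mathbb{Z}}$ (a closed set invariant under the left shift $(\sigma x)(n)=x(n+1)$ in which every orbit $\{\sigma^n x: n\in\mathbb{Z}\}$ is dense), such that 1. $(X,\sigma)$ has exactly $d$ ergodic Borel probability measures; 2. $(X,\sigma)$ has no nonergodic generic measure, where a $\sigma$-invariant Borel probability measure $\mu$ on $X$ is called generic if there is a point $x\in X$ with $\lim_{N\to\infty}\frac1N\sum_{n=0}^{N-1}f(\sigma^n x)=\int f\,d\mu$ for every continuous $f\colon X\to\mathbb{R}$; 3. if $P_X(n)$ denotes the number of words of length $n$ that occur in elements of $X$, then $$\liminf_{n\to\infty}\frac{P_X(n)}{n}=d\qquad\text{and}\qquad\limsup_{n\to\infty}\frac{P_X(n)}{n}=d+1.$$ -/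

import Mathlib

open Filter Topology MeasureTheory
open SymbolicDynamics.FullShift (Subshift shift)

/-- The left shift `(σ x)(n) = x(n + 1)`, as a self-map of a two-sided subshift `X`. -/
def shiftMap {A : Type*} [TopologicalSpace A] (X : Subshift A ℤ) : X.carrier → X.carrier :=
  (X.mapsTo 1).restrict (shift (1 : ℤ)) X.carrier X.carrier

/-- `X` is minimal: the closure of the two-sided orbit `{σⁿ x : n ∈ ℤ}` of every `x ∈ X`
is all of `X`. -/
def IsMinimalSubshift {A : Type*} [TopologicalSpace A] (X : Subshift A ℤ) : Prop :=
  ∀ x ∈ X.carrier, closure (Set.range fun n : ℤ => shift n x) = X.carrier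

/-- `𝓛_n(X)`: the words of length `n` that occur at some position of some point of `X`. -/
def wordsOfLength {A : Type*} [TopologicalSpace A] (X : Subshift A ℤ) (n : ℕ) :
    Set (Fin n → A) :=
  {w | ∃ x ∈ X.carrier, ∃ m : ℤ, ∀ i : Fin n, w i = x (m + (i : ℕ))}

/-- The complexity function `P_X(n) = |𝓛_n(X)|`. -/
noncomputable def complexityFn {A : Type*} [TopologicalSpace A] (X : Subshift A ℤ) (n : ℕ) : ℕ :=
  (wordsOfLength X n).ncard

/-- `x` is a generic point for `μ`: the averages `(1/N) ∑_{n < N} f(Tⁿ x)` converge to `∫ f dμ`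
for every continuous real function `f`. -/
def IsGenericPointFor {Y : Type*} [TopologicalSpace Y] [MeasurableSpace Y] (T : Y → Y)
    (μ : Measure Y) (x : Y) : Prop :=
  ∀ f : Y → ℝ, Continuous f →
    Tendsto (fun N : ℕ => birkhoffAverage ℝ T f N x) atTop (𝓝 (∫ y, f y ∂μ))

/-- `μ` is a generic measure of `(Y, T)`: an invariant probability measure that has a generic
point. -/
def IsGenericMeasure {Y : Type*} [TopologicalSpace Y] [MeasurableSpace Y] (T : Y → Y)
    (μ : Measure Y) : Prop :=
  IsProbabilityMeasure μ ∧ MeasurePreserving T μ μ ∧ ∃ x, IsGenericPointFor T μ x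

/-! The words `T.w m` fall into d families according to m mod d. The word `T.w (m + d)` is a cyclic
sweep w_m^(e 0) w_{m+1}^(e 1) … w_{m+d-1}^(e (d-1)) w_m^a whose lengths satisfy tail ≪ run 1 ≪ … ≪
run (d-1) ≪ run 0, where ≪ stands for a factor of at least `scaleGap d m`, which grows exponentially
in m.

Local structure: from level J on, every run has length at least `T.tail J`, and neighbouring runs
follow the cyclic order of w_J, …, w_{J+d-1}. A word of length at most `T.tail J` therefore crosses
at most one of d possible transitions (`good_wordPow`, `legal_of_inLang`).

Complexity: counting such windows gives P(n) ≤ dn + (sum of d word lengths), and at n = tail J the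
sum is negligible, so the ratio is about d. Conversely, the suffixes of …w_m w_m w_m are right
special: they are followed by the first letter of w_m and by that of w_{m+1}. The d residues give
P(n+1) - P(n) ≥ d. For tail m < n ≤ run m 0 the suffixes belonging to m and to m + d differ as well,
so the growth is at least d + 1. Since run m 0 dwarfs tail m, the ratio is about d + 1 at n = run m
0, and `gap_mul_card_lang_le` shows that it is asymptotically never larger.

Measures: as w_m^(e 0) fills almost all of w_{m+d}, Birkhoff averages along w_m persist along
w_{m+d}, w_{m+2d}, … up to a summable error (`BlockBound.add_mul_dim`), which yields one limit
measure per residue. On [0, tail J) every point is a piece of one periodic sequence followed by a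
piece of another, so its averages are close to convex combinations of two limit measures.
Integrating, every invariant probability measure is a convex combination of the d limit measures.
Letter frequencies separate these, so they are exactly the ergodic ones (`ergodic_iff_exists_eq`).
For a generic point one stops at the end of the first piece if that piece is long compared with the
base words, and at tail J otherwise, when the first piece is negligible. Either way the average is
close to a single limit measure (`eq_limitMeasure_of_isGenericPointFor`). -/

section Windows

/-! ### Powers of words, windows and periodic sequences. -/

variable {α : Type*}

/-- The `k`-th power of a word. -/
def wordPow (k : ℕ) (w : List α) : List α := (List.replicate k w).flatten

lemma wordPow_zero (w : List α) : wordPow 0 w = [] := rfl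

lemma wordPow_succ (k : ℕ) (w : List α) : wordPow (k + 1) w = w ++ wordPow k w := by
  simp [wordPow, List.replicate_succ]

lemma wordPow_one (w : List α) : wordPow 1 w = w := by simp [wordPow]

@[simp] lemma length_wordPow (k : ℕ) (w : List α) : (wordPow k w).length = k * w.length := by
  simp [wordPow]

/-- The window of length `n` of the bi-infinite sequence `z` starting at position `t`. -/
def window (z : ℤ → α) (t : ℤ) (n : ℕ) : List α := List.ofFn fun k : Fin n => z (t + k)

@[simp] lemma length_window (z : ℤ → α) (t : ℤ) (n : ℕ) : (window z t n).length = n := by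
  simp [window]

@[simp] lemma window_zero (z : ℤ → α) (t : ℤ) : window z t 0 = [] := by simp [window]

lemma getElem_window (z : ℤ → α) (t : ℤ) (n k : ℕ) (h : k < (window z t n).length) :
    (window z t n)[k] = z (t + k) := by
  simp [window]

lemma window_eq_window_iff {z z' : ℤ → α} {t t' : ℤ} {n : ℕ} :
    window z t n = window z' t' n ↔ ∀ k : ℕ, k < n → z (t + k) = z' (t' + k) := by
  rw [window, window, List.ofFn_inj, funext_iff]
  exact ⟨fun h k hk => h ⟨k, hk⟩, fun h k => h k k.2⟩

lemma window_add (z : ℤ → α) (t : ℤ) (m n : ℕ) :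
    window z t (m + n) = window z t m ++ window z (t + m) n := by
  simp only [window, List.ofFn_add]
  congr 2
  ext k
  simp [add_assoc]

lemma window_succ (z : ℤ → α) (t : ℤ) (n : ℕ) :
    window z t (n + 1) = window z t n ++ [z (t + n)] := by
  rw [window_add]
  simp [window]

lemma eq_window_of_append {z : ℤ → α} {t : ℤ} {n : ℕ} {u v : List α}
    (h : u ++ v = window z t n) :
    u = window z t u.length ∧ v = window z (t + u.length) v.length := by
  have hn : n = u.length + v.length := by simpa using (congrArg List.length h).symm
  subst hn
  rw [window_add] at h
  exact List.append_inj h (by simp)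

lemma eq_window_of_isPrefix {z : ℤ → α} {t : ℤ} {n : ℕ} {v : List α}
    (h : v <+: window z t n) : v = window z t v.length := by
  obtain ⟨u, hu⟩ := h
  exact (eq_window_of_append hu).1

lemma eq_window_of_isSuffix {z : ℤ → α} {t : ℤ} {n : ℕ} {v : List α}
    (h : v <:+ window z t n) : v = window z (t + n - v.length) v.length := by
  obtain ⟨u, hu⟩ := h
  have h1 := (eq_window_of_append hu).2
  have hn : n = u.length + v.length := by simpa using (congrArg List.length hu).symm
  have : t + n - v.length = t + u.length := by rw [hn]; push_cast; ring
  rwa [this]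

lemma eq_window_of_isInfix {z : ℤ → α} {t : ℤ} {n : ℕ} {v : List α}
    (h : v <:+: window z t n) :
    ∃ s : ℕ, s + v.length ≤ n ∧ v = window z (t + s) v.length := by
  obtain ⟨u, u', hu⟩ := h
  have hn : n = u.length + v.length + u'.length := by
    simpa [add_assoc] using (congrArg List.length hu).symm
  have h1 := (eq_window_of_append hu).1
  rw [List.length_append] at h1
  exact ⟨u.length, by omega, (eq_window_of_append h1).2⟩

lemma window_isInfix (z : ℤ → α) (t : ℤ) {n s m : ℕ} (h : s + m ≤ n) :
    window z (t + s) m <:+: window z t n := by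
  obtain ⟨r, rfl⟩ := Nat.exists_eq_add_of_le h
  rw [window_add, window_add]
  exact ⟨_, _, rfl⟩

lemma window_isInfix_of_le (z : ℤ → α) {t p : ℤ} {n m : ℕ} (h₁ : t ≤ p) (h₂ : p + m ≤ t + n) :
    window z p m <:+: window z t n := by
  have := window_isInfix z t (n := n) (s := (p - t).toNat) (m := m) (by omega)
  rwa [show t + ((p - t).toNat : ℤ) = p by omega] at this

variable [Inhabited α]

/-- The bi-infinite periodic sequence `…www.www…`. -/
def periodicSeq (w : List α) (t : ℤ) : α := w.getD (t % w.length).toNat default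

/-- The bi-infinite sequence `…www.vvv…`. -/
def jointSeq (w v : List α) (t : ℤ) : α := if t < 0 then periodicSeq w t else periodicSeq v t

lemma jointSeq_of_neg {w v : List α} {t : ℤ} (h : t < 0) : jointSeq w v t = periodicSeq w t :=
  if_pos h

lemma jointSeq_of_nonneg {w v : List α} {t : ℤ} (h : 0 ≤ t) :
    jointSeq w v t = periodicSeq v t := if_neg (not_lt.mpr h)

lemma periodicSeq_add_mul (w : List α) (t c : ℤ) :
    periodicSeq w (t + w.length * c) = periodicSeq w t := by
  simp [periodicSeq]

lemma periodicSeq_natCast (w : List α) {k : ℕ} (h : k < w.length) :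
    periodicSeq w k = w[k] := by
  have h1 : ((k : ℤ) % w.length) = k := Int.emod_eq_of_lt (by omega) (by omega)
  simp [periodicSeq, h1, h]

lemma window_periodicSeq_add_mul (w : List α) (t c : ℤ) (n : ℕ) :
    window (periodicSeq w) (t + w.length * c) n = window (periodicSeq w) t n := by
  rw [window_eq_window_iff]
  intro k _
  rw [← periodicSeq_add_mul w (t + k) c]
  congr 1
  ring

lemma window_periodicSeq_emod (w : List α) (t : ℤ) (n : ℕ) :
    window (periodicSeq w) (t % w.length) n = window (periodicSeq w) t n := by
  rw [← window_periodicSeq_add_mul w (t % w.length) (t / w.length), Int.emod_add_mul_ediv]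

lemma window_periodicSeq_length (w : List α) : window (periodicSeq w) 0 w.length = w := by
  apply List.ext_getElem (by simp)
  intro k h1 h2
  rw [getElem_window, zero_add, periodicSeq_natCast]

lemma window_periodicSeq_mul_length (w : List α) (k : ℕ) :
    window (periodicSeq w) 0 (k * w.length) = wordPow k w := by
  induction k with
  | zero => simp [wordPow_zero]
  | succ k ih =>
    rw [wordPow_succ, add_mul, one_mul, add_comm, window_add, window_periodicSeq_length, ← ih]
    congr 1
    simpa using window_periodicSeq_add_mul w 0 1 (k * w.length)

lemma periodicSeq_append_left {z A B : List α} (hz : z = A ++ B) {t : ℤ} (h0 : 0 ≤ t)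
    (h1 : t < A.length) : periodicSeq z t = periodicSeq A t := by
  lift t to ℕ using h0
  have h1 : t < A.length := by exact_mod_cast h1
  rw [periodicSeq_natCast _ (by rw [hz, List.length_append]; omega), periodicSeq_natCast _ h1]
  simp [hz, h1]

lemma periodicSeq_append_right {z A B : List α} (hz : z = A ++ B) {t : ℤ} (h0 : 0 ≤ t)
    (h1 : t < B.length) : periodicSeq z (A.length + t) = periodicSeq B t := by
  lift t to ℕ using h0
  have h1 : t < B.length := by exact_mod_cast h1
  have : ((A.length : ℤ) + t) = ((A.length + t : ℕ) : ℤ) := by push_cast; ring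
  rw [this, periodicSeq_natCast _ (by rw [hz, List.length_append]; omega),
    periodicSeq_natCast _ h1]
  simp [hz]

lemma periodicSeq_wordPow (w : List α) {k : ℕ} {t : ℤ} (h0 : 0 ≤ t) (h1 : t < k * w.length) :
    periodicSeq (wordPow k w) t = periodicSeq w t := by
  lift t to ℕ using h0
  have h1 : t < (wordPow k w).length := by rw [length_wordPow]; exact_mod_cast h1
  rw [periodicSeq_natCast _ h1]
  simp_rw [← window_periodicSeq_mul_length w k]
  rw [getElem_window, zero_add]

/-- The values of a periodic sequence along a power inside its period. -/
lemma periodicSeq_append_wordPow_append {z A B w : List α} {k : ℕ}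
    (hz : z = A ++ wordPow k w ++ B) {t : ℤ} (h0 : 0 ≤ t) (h1 : t < k * w.length) :
    periodicSeq z (A.length + t) = periodicSeq w t := by
  have hz' : z = A ++ (wordPow k w ++ B) := by rw [hz, List.append_assoc]
  have hl : ((wordPow k w).length : ℤ) = k * w.length := by simp
  rw [periodicSeq_append_right hz' h0 (by rw [List.length_append]; push_cast; omega),
    periodicSeq_append_left rfl h0 (by rw [hl]; exact h1), periodicSeq_wordPow w h0 h1]

end Windows

/-! ### Existence of towers with the required growth. -/

section Scheme

/-- The ratio between consecutive scales of a tower of words. -/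
def scaleGap (d m : ℕ) : ℕ := d * 2 ^ (m + 4)

/-- A sequence of words over `Fin d` in which `w (m + d)` is a long power of `w m`, followed by
comparatively short powers of `w (m + 1), …, w (m + d - 1)` of rapidly increasing lengths and by an
even shorter power of `w m`. -/
structure WordTower (d : ℕ) [NeZero d] where
  w : ℕ → List (Fin d)
  a : ℕ → ℕ
  e : ℕ → ℕ → ℕ
  w_init : ∀ i < d, w i = [Fin.ofNat d i]
  w_rec : ∀ m, w (m + d) =
    (List.range d).flatMap (fun j => wordPow (e m j) (w (m + j))) ++ wordPow (a m) (w m)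
  le_tail : ∀ m, scaleGap d m ^ 2 * (w (m + d - 1)).length ≤ a m * (w m).length
  tail_le : ∀ m, scaleGap d m * (a m * (w m).length) ≤ e m 1 * (w (m + 1)).length
  run_le : ∀ m j, 1 ≤ j → j + 1 < d →
    scaleGap d m * (e m j * (w (m + j)).length) ≤ e m (j + 1) * (w (m + (j + 1))).length
  last_le : ∀ m, scaleGap d m * (e m (d - 1) * (w (m + d - 1)).length) ≤ e m 0 * (w m).length

namespace WordTower

/-- The exponents used in the construction of a tower from the length `L` of the longest word. -/
def exponent (d m L j : ℕ) : ℕ :=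
  if j = 0 then scaleGap d m ^ (d + 2) * L ^ 2 else scaleGap d m ^ (j + 2) * L

/-- The next word of the tower, given the last `d` words. -/
def nextWord (d m : ℕ) (u : ℕ → List (Fin d)) : List (Fin d) :=
  (List.range d).flatMap (fun j => wordPow (exponent d m (u (d - 1)).length j) (u j)) ++
    wordPow (scaleGap d m ^ 2 * (u (d - 1)).length) (u 0)

/-- The last `d` words at each step of the construction. -/
def state (d : ℕ) [NeZero d] : ℕ → ℕ → List (Fin d)
  | 0, i => [Fin.ofNat d i]
  | m + 1, i => if i + 1 < d then state d m (i + 1) else nextWord d m (state d m)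

/-- Each step of the construction shifts the d slots by one, so slot 0 alone records the whole
sequence of words. -/
lemma state_eq (d : ℕ) [NeZero d] {j : ℕ} : ∀ m, j < d → state d m j = state d (m + j) 0 := by
  induction j with
  | zero => simp
  | succ j ih =>
    intro m hj
    have h : state d (m + 1) j = state d m (j + 1) := by rw [state, if_pos hj]
    rw [← h, ih (m + 1) (by omega)]
    congr 1
    ring

lemma state_rec (d : ℕ) [NeZero d] (m : ℕ) : state d (m + d) 0 =
    (List.range d).flatMap (fun j =>
      wordPow (exponent d m (state d (m + d - 1) 0).length j) (state d (m + j) 0)) ++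
    wordPow (scaleGap d m ^ 2 * (state d (m + d - 1) 0).length) (state d m 0) := by
  have hd : 0 < d := Nat.pos_of_ne_zero (NeZero.ne d)
  have h := state_eq d (j := d - 1) (m + 1) (by omega)
  rw [show m + 1 + (d - 1) = m + d by omega, state, if_neg (by omega)] at h
  have h1 : state d m (d - 1) = state d (m + d - 1) 0 := by
    rw [state_eq d m (by omega), show m + (d - 1) = m + d - 1 by omega]
  rw [← h, nextWord, h1]
  congr 1
  rw [List.flatMap, List.flatMap]
  congr 1
  apply List.map_congr_left
  intro j hj
  rw [state_eq d m (List.mem_range.1 hj)]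

lemma length_flatMap_range_ge {α : Type*} {d j : ℕ} (hj : j < d) (f : ℕ → List α) :
    (f j).length ≤ ((List.range d).flatMap f).length := by
  rw [List.length_flatMap]
  exact List.le_sum_of_mem (List.mem_map.2 ⟨j, List.mem_range.2 hj, rfl⟩)

lemma scaleGap_pos {d : ℕ} [NeZero d] (m : ℕ) : 0 < scaleGap d m := by
  have hd : 0 < d := Nat.pos_of_ne_zero (NeZero.ne d)
  unfold scaleGap
  positivity

lemma length_state_mono (d : ℕ) [NeZero d] :
    Monotone fun m => (state d m 0).length := by
  have hd : 0 < d := Nat.pos_of_ne_zero (NeZero.ne d)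
  have hpos : ∀ m, 0 < (state d m 0).length := by
    intro m
    induction m using Nat.strong_induction_on with
    | _ m ih =>
      rcases lt_or_ge m d with h | h
      · have := state_eq d 0 h
        rw [zero_add] at this
        simp [← this, state]
      · obtain ⟨r, rfl⟩ := Nat.exists_eq_add_of_le' h
        rw [state_rec, List.length_append, length_wordPow]
        have h1 := ih r (by omega)
        have h2 := ih (r + d - 1) (by omega)
        have h3 := scaleGap_pos (d := d) r
        positivity
  refine monotone_nat_of_le_succ fun m => ?_
  rcases lt_or_ge (m + 1) d with h | h
  · have h1 := state_eq d 0 h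
    have h2 := state_eq d 0 (show m < d by omega)
    rw [zero_add] at h1 h2
    rw [← h1, ← h2]
    simp [state]
  · obtain ⟨r, hr⟩ := Nat.exists_eq_add_of_le' h
    have hm : m = r + d - 1 := by omega
    rw [hr, state_rec, List.length_append]
    refine le_trans ?_ (Nat.le_add_right _ _)
    refine le_trans ?_ (length_flatMap_range_ge (show d - 1 < d by omega) _)
    rw [length_wordPow, show r + (d - 1) = m by omega, show r + d - 1 = m by omega]
    have h2 := hpos m
    have h3 := scaleGap_pos (d := d) r
    apply Nat.le_mul_of_pos_left
    unfold exponent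
    split_ifs <;> positivity

/-- The tower with explicit exponents. -/
def standard (d : ℕ) [NeZero d] (hd : 1 < d) : WordTower d where
  w m := state d m 0
  a m := scaleGap d m ^ 2 * (state d (m + d - 1) 0).length
  e m := exponent d m (state d (m + d - 1) 0).length
  w_init i hi := by
    have := state_eq d 0 hi
    rw [zero_add] at this
    rw [← this, state]
  w_rec m := state_rec d m
  le_tail m := by
    have h : 1 ≤ (state d m 0).length :=
      le_trans (by simp [state]) (length_state_mono d (Nat.zero_le m))
    exact Nat.le_mul_of_pos_right _ h
  tail_le m := by
    have h := length_state_mono d (Nat.le_succ m)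
    dsimp only at h
    rw [exponent, if_neg one_ne_zero]
    calc _ = scaleGap d m ^ 3 * (state d (m + d - 1) 0).length * (state d m 0).length := by ring
      _ ≤ _ := Nat.mul_le_mul_left _ h
  run_le m j hj hjd := by
    have h := length_state_mono d (show m + j ≤ m + (j + 1) by omega)
    dsimp only at h
    rw [exponent, if_neg (by omega), exponent, if_neg (by omega)]
    calc _ = scaleGap d m ^ (j + 1 + 2) * (state d (m + d - 1) 0).length
          * (state d (m + j) 0).length := by ring
      _ ≤ _ := Nat.mul_le_mul_left _ h
  last_le m := by
    have h : 1 ≤ (state d m 0).length :=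
      le_trans (by simp [state]) (length_state_mono d (Nat.zero_le m))
    -- Run `d - 1` is a power of the longest word, of length L, whereas run 0 is a power of a word
    -- possibly of length 1. The factor `L ^ 2` in exponent 0 compensates for this.
    rw [exponent, if_neg (by omega), exponent, if_pos rfl]
    calc _ = scaleGap d m ^ (d - 1 + 2 + 1) * (state d (m + d - 1) 0).length ^ 2 * 1 := by ring
      _ = scaleGap d m ^ (d + 2) * (state d (m + d - 1) 0).length ^ 2 * 1 := by
        rw [show d - 1 + 2 + 1 = d + 2 by omega]
      _ ≤ _ := Nat.mul_le_mul_left _ h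

end WordTower

end Scheme

/-! ### Length estimates and the run structure of `T.w (m + d)`. -/

namespace WordTower

variable {d : ℕ} [NeZero d] (T : WordTower d)

/-- The length of the `m`-th word. -/
def len (m : ℕ) : ℕ := (T.w m).length

/-- The length of the `j`-th run in `T.w (m + d)`. -/
def run (m j : ℕ) : ℕ := T.e m j * T.len (m + j)

/-- The length of the last run in `T.w (m + d)`. -/
def tail (m : ℕ) : ℕ := T.a m * T.len m

lemma length_w (m : ℕ) : (T.w m).length = T.len m := rfl

lemma dim_pos : 0 < d := Nat.pos_of_ne_zero (NeZero.ne d)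

lemma len_init {m : ℕ} (h : m < d) : T.len m = 1 := by simp [len, T.w_init m h]

lemma length_flatMap_range {α : Type*} (f : ℕ → List α) (n : ℕ) :
    ((List.range n).flatMap f).length = ∑ j ∈ Finset.range n, (f j).length := by
  induction n with
  | zero => simp
  | succ n ih => rw [List.range_succ, List.flatMap_append, List.length_append, ih,
      Finset.sum_range_succ]; simp

lemma len_add (m : ℕ) :
    T.len (m + d) = ∑ j ∈ Finset.range d, T.run m j + T.tail m := by
  rw [len, T.w_rec, List.length_append, length_flatMap_range, length_wordPow]
  simp [run, tail, len]

lemma exists_tail_split (m : ℕ) : ∃ A : List (Fin d),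
    A.length = ∑ i ∈ Finset.range d, T.run m i ∧
      T.w (m + d) = A ++ wordPow (T.a m) (T.w m) :=
  ⟨_, by rw [length_flatMap_range]; simp [run, len], T.w_rec m⟩

lemma exists_run_split (m : ℕ) {j : ℕ} (hj : j < d) : ∃ A B : List (Fin d),
    A.length = ∑ i ∈ Finset.range j, T.run m i ∧
      T.w (m + d) = A ++ wordPow (T.e m j) (T.w (m + j)) ++ B := by
  obtain ⟨r, rfl⟩ : ∃ r, d = j + (1 + r) := ⟨d - j - 1, by omega⟩
  refine ⟨(List.range j).flatMap (fun j => wordPow (T.e m j) (T.w (m + j))), ?_, ?_, ?_⟩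
  rotate_left 2
  · rw [T.w_rec, List.range_add, List.flatMap_append, List.range_add, List.map_append,
      List.flatMap_append]
    simp only [List.append_assoc]
    simp
    rfl
  · rw [length_flatMap_range]
    simp [run, len]

lemma len_pos (m : ℕ) : 0 < T.len m := by
  induction m using Nat.strong_induction_on with
  | _ m ih =>
    rcases lt_or_ge m d with h | h
    · rw [T.len_init h]; exact one_pos
    · have hd := dim_pos (d := d)
      obtain ⟨r, rfl⟩ := Nat.exists_eq_add_of_le' h
      have h1 := ih (r + d - 1) (by omega)
      have h2 := T.le_tail r
      have h3 := scaleGap_pos (d := d) r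
      rw [T.length_w, T.length_w] at h2
      rw [T.len_add, tail]
      have : 0 < scaleGap d r ^ 2 * T.len (r + d - 1) := by positivity
      omega

lemma gap_sq_le_tail (m : ℕ) : scaleGap d m ^ 2 * T.len (m + d - 1) ≤ T.tail m := T.le_tail m

lemma one_le_gap (m : ℕ) : 1 ≤ scaleGap d m := scaleGap_pos m

lemma gap_tail_le (m : ℕ) : scaleGap d m * T.tail m ≤ T.run m 1 := T.tail_le m

lemma gap_run_le (m : ℕ) {j : ℕ} (hj : 1 ≤ j) (hjd : j + 1 < d) :
    scaleGap d m * T.run m j ≤ T.run m (j + 1) := T.run_le m j hj hjd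

lemma gap_run_last_le (m : ℕ) : scaleGap d m * T.run m (d - 1) ≤ T.run m 0 := by
  have hd := dim_pos (d := d)
  have := T.last_le m
  rwa [show m + d - 1 = m + (d - 1) by omega] at this

lemma gap_tail_le_run (hd : 1 < d) (m : ℕ) {j : ℕ} (hjd : j < d) :
    scaleGap d m * T.tail m ≤ T.run m j := by
  have key : ∀ j, 1 ≤ j → j < d → scaleGap d m * T.tail m ≤ T.run m j := by
    intro j hj
    induction j, hj using Nat.le_induction with
    | base => exact fun _ => T.gap_tail_le m
    | succ j hj ih =>
      intro h
      exact ((ih (by omega)).trans (Nat.le_mul_of_pos_left _ (scaleGap_pos m))).trans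
        (T.gap_run_le m hj h)
  rcases Nat.eq_zero_or_pos j with rfl | hj
  · exact ((key (d - 1) (by omega) (by omega)).trans
      (Nat.le_mul_of_pos_left _ (scaleGap_pos m))).trans (T.gap_run_last_le m)
  · exact key j hj hjd

lemma tail_le_run (hd : 1 < d) (m : ℕ) {j : ℕ} (hjd : j < d) : T.tail m ≤ T.run m j :=
  (Nat.le_mul_of_pos_left _ (scaleGap_pos m)).trans (T.gap_tail_le_run hd m hjd)

lemma gap_run_le_run_zero (m : ℕ) {j : ℕ} (hj : 1 ≤ j) (hjd : j < d) :
    scaleGap d m * T.run m j ≤ T.run m 0 := by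
  obtain ⟨r, hr⟩ : ∃ r, j + r = d - 1 := ⟨d - 1 - j, by omega⟩
  induction r generalizing j with
  | zero =>
    obtain rfl : j = d - 1 := by omega
    exact T.gap_run_last_le m
  | succ r ih =>
    have := ih (j := j + 1) (by omega) (by omega) (by omega)
    exact ((T.gap_run_le m hj (by omega)).trans
      (Nat.le_mul_of_pos_left _ (scaleGap_pos m))).trans this

lemma len_le_tail (m : ℕ) : T.len (m + d - 1) ≤ T.tail m :=
  (Nat.le_mul_of_pos_left _ (pow_pos (scaleGap_pos m) 2)).trans (T.gap_sq_le_tail m)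

lemma tail_pos (m : ℕ) : 0 < T.tail m := (T.len_pos _).trans_le (T.len_le_tail m)

lemma a_pos (m : ℕ) : 0 < T.a m := Nat.pos_of_mul_pos_right (T.tail_pos m)

lemma e_pos (hd : 1 < d) (m : ℕ) {j : ℕ} (hj : j < d) : 0 < T.e m j :=
  Nat.pos_of_mul_pos_right ((T.tail_pos m).trans_le (T.tail_le_run hd m hj))

lemma run_le_len (m : ℕ) {j : ℕ} (hj : j < d) : T.run m j ≤ T.len (m + d) := by
  rw [T.len_add]
  exact (Finset.single_le_sum (f := fun j => T.run m j) (fun _ _ => Nat.zero_le _)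
    (Finset.mem_range.2 hj)).trans (Nat.le_add_right _ _)

lemma len_mono (hd : 1 < d) : Monotone T.len := by
  refine monotone_nat_of_le_succ fun m => ?_
  rcases lt_or_ge (m + 1) d with h | h
  · rw [T.len_init h, T.len_init (by omega)]
  · obtain ⟨r, hr⟩ := Nat.exists_eq_add_of_le' h
    rw [hr]
    calc T.len m = T.len (r + d - 1) := by congr 1; omega
      _ ≤ T.tail r := T.len_le_tail r
      _ ≤ _ := (T.tail_le_run hd r dim_pos).trans (T.run_le_len r dim_pos)

/-- The longest base word at level `m + 1` is `T.w (m + d)`, which contains the first run. Hence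
tail m ≤ run m 0 ≤ tail (m + 1) ≤ …, and these thresholds organise all length scales. -/
lemma run_zero_le_tail_succ (m : ℕ) : T.run m 0 ≤ T.tail (m + 1) := by
  have := T.len_le_tail (m + 1)
  rw [show m + 1 + d - 1 = m + d by omega] at this
  exact (T.run_le_len m dim_pos).trans this

lemma tail_mono (hd : 1 < d) : Monotone T.tail :=
  monotone_nat_of_le_succ fun m =>
    (T.tail_le_run hd m dim_pos).trans (T.run_zero_le_tail_succ m)

lemma run_zero_mono (hd : 1 < d) : Monotone fun m => T.run m 0 :=
  monotone_nat_of_le_succ fun m =>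
    (T.run_zero_le_tail_succ m).trans (T.tail_le_run hd _ dim_pos)

lemma le_scaleGap (m : ℕ) : m + 2 ≤ scaleGap d m := by
  have h1 : m + 4 < 2 ^ (m + 4) := Nat.lt_two_pow_self
  have := Nat.le_mul_of_pos_left (2 ^ (m + 4)) (dim_pos (d := d))
  unfold scaleGap
  omega

lemma le_tail_self (m : ℕ) : m ≤ T.tail m := by
  have h := T.gap_sq_le_tail m
  have h1 := le_scaleGap (d := d) m
  have h2 := T.len_pos (m + d - 1)
  nlinarith

/-- All but a small proportion of `T.w (m + d)` is covered by its first run. -/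
lemma len_add_le (m : ℕ) (hd : 1 < d) :
    2 ^ (m + 4) * (T.len (m + d) - T.run m 0) ≤ T.run m 0 := by
  have h0 : T.len (m + d) - T.run m 0 = ∑ j ∈ Finset.Ico 1 d, T.run m j + T.tail m := by
    rw [T.len_add, Finset.range_eq_Ico, Finset.sum_eq_sum_Ico_succ_bot dim_pos]
    simp; omega
  have h1 : ∀ j ∈ Finset.Ico 1 d, scaleGap d m * T.run m j ≤ T.run m 0 := fun j hj =>
    T.gap_run_le_run_zero m (Finset.mem_Ico.1 hj).1 (Finset.mem_Ico.1 hj).2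
  have h2 := Finset.sum_le_sum h1
  have h3 := T.gap_tail_le_run hd m dim_pos
  rw [← Finset.mul_sum] at h2
  simp only [Finset.sum_const, Nat.card_Ico, smul_eq_mul] at h2
  have h4 : scaleGap d m * (T.len (m + d) - T.run m 0) ≤ d * T.run m 0 := by
    rw [h0, mul_add]
    calc _ ≤ (d - 1) * T.run m 0 + T.run m 0 := add_le_add h2 h3
      _ = (d - 1 + 1) * T.run m 0 := by ring
      _ = _ := by rw [Nat.sub_add_cancel dim_pos]
  rw [scaleGap, mul_assoc] at h4
  exact Nat.le_of_mul_le_mul_left h4 dim_pos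

lemma e_zero_ge_two (hd : 1 < d) (m : ℕ) : 2 ≤ T.e m 0 := by
  have h1 := T.gap_tail_le_run hd m (dim_pos (d := d))
  have h2 := T.len_le_tail m
  have h3 := T.len_mono hd (show m ≤ m + d - 1 by omega)
  have h4 := le_scaleGap (d := d) m
  have h5 := T.len_pos m
  simp only [run, add_zero] at h1
  have : 2 * T.len m ≤ T.e m 0 * T.len m := by nlinarith
  exact Nat.le_of_mul_le_mul_right this h5

lemma isInfix_wordPow {α : Type*} (w : List α) {k : ℕ} (hk : 0 < k) : w <:+: wordPow k w := by
  obtain ⟨r, rfl⟩ := Nat.exists_eq_add_of_lt hk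
  rw [zero_add, wordPow_succ]
  exact (List.prefix_append _ _).isInfix

lemma isInfix_add (hd : 1 < d) (m : ℕ) {j : ℕ} (hj : j < d) : T.w (m + j) <:+: T.w (m + d) := by
  obtain ⟨A, B, -, h⟩ := T.exists_run_split m hj
  rw [h]
  exact (isInfix_wordPow _ (T.e_pos hd m hj)).trans (List.infix_append _ _ _)

/-- Each word from level d on contains the d preceding ones. The bound `d ≤ k` is needed because the
initial words are distinct letters. -/
lemma isInfix_of_le (hd : 1 < d) {m k : ℕ} (hmk : m ≤ k) (hk : d ≤ k) : T.w m <:+: T.w k := by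
  induction k using Nat.strong_induction_on with
  | _ k ih =>
    rcases hmk.eq_or_lt with rfl | h
    · exact List.infix_rfl
    obtain ⟨r, rfl⟩ := Nat.exists_eq_add_of_le' hk
    rcases lt_or_ge m r with h1 | h1
    · rcases lt_or_ge (r + d - 1) d with h2 | h2
      · omega
      · refine (ih (r + d - 1) (by omega) (by omega) h2).trans ?_
        have := T.isInfix_add hd r (show d - 1 < d by omega)
        rwa [show r + (d - 1) = r + d - 1 by omega] at this
    · have := T.isInfix_add hd r (show m - r < d by omega)
      rwa [show r + (m - r) = m by omega] at this

lemma periodicSeq_run (m : ℕ) {j : ℕ} (hj : j < d) {t : ℤ} (h0 : 0 ≤ t) (h1 : t < T.run m j) :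
    periodicSeq (T.w (m + d)) ((∑ i ∈ Finset.range j, T.run m i : ℕ) + t) =
      periodicSeq (T.w (m + j)) t := by
  obtain ⟨A, B, hA, h⟩ := T.exists_run_split m hj
  rw [← hA]
  exact periodicSeq_append_wordPow_append h h0 (by rw [run] at h1; exact_mod_cast h1)

/-- The powers of `T.w m` at the end and at the beginning of `T.w (m + d)` merge. -/
lemma periodicSeq_merged (m : ℕ) {t : ℤ} (h0 : -(T.tail m : ℤ) ≤ t) (h1 : t < T.run m 0) :
    periodicSeq (T.w (m + d)) t = periodicSeq (T.w m) t := by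
  rcases lt_or_ge t 0 with h | h
  · obtain ⟨A, hA, hw⟩ := T.exists_tail_split m
    have h2 : T.w (m + d) = A ++ wordPow (T.a m) (T.w m) ++ [] := by rw [hw]; simp
    have h3 := periodicSeq_append_wordPow_append h2 (t := t + T.tail m) (by omega)
      (by rw [T.length_w, tail]; push_cast; omega)
    -- Translating by one full period moves a negative position into the final block; the tail
    -- length is a multiple of `T.len m`, so the phase agrees.
    have h4 := T.len_add m
    rw [hA] at h3
    rw [← periodicSeq_add_mul (T.w (m + d)) t 1, T.length_w, h4]
    have h5 : t + ((∑ j ∈ Finset.range d, T.run m j + T.tail m : ℕ) : ℤ) * 1 =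
      ((∑ j ∈ Finset.range d, T.run m j : ℕ) : ℤ) + (t + T.tail m) := by push_cast; ring
    rw [h5, h3, ← periodicSeq_add_mul (T.w m) t (T.a m), T.length_w, tail]
    congr 1
    push_cast
    ring
  · have := T.periodicSeq_run m dim_pos h h1
    simpa using this

/-- `T.w (m + d)` begins and ends with copies of `T.w m`, so its extreme letters depend only on m
mod d. They identify the residue of a word. -/
lemma periodicSeq_zero_neg_one (hd : 1 < d) (m : ℕ) :
    periodicSeq (T.w m) 0 = Fin.ofNat d m ∧ periodicSeq (T.w m) (-1) = Fin.ofNat d m := by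
  induction m using Nat.strong_induction_on with
  | _ m ih =>
    rcases lt_or_ge m d with h | h
    · rw [T.w_init m h]
      simp [periodicSeq]
    · obtain ⟨r, rfl⟩ := Nat.exists_eq_add_of_le' h
      have h1 := T.tail_pos r
      have h2 := T.tail_le_run hd r (dim_pos (d := d))
      rw [T.periodicSeq_merged r (by omega) (by omega),
        T.periodicSeq_merged r (by omega) (by omega)]
      have : Fin.ofNat d (r + d) = Fin.ofNat d r := by ext; simp
      rw [this]
      exact ih r (by omega)

end WordTower

/-! ### Short words cross at most one transition. -/

namespace WordTower

variable {d : ℕ} [NeZero d] (T : WordTower d)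

/-- The words `T.w J, …, T.w (J + d - 1)`, extended periodically. -/
def base (J q : ℕ) : List (Fin d) := T.w (J + q % d)

lemma base_of_lt (J : ℕ) {q : ℕ} (hq : q < d) : T.base J q = T.w (J + q) := by
  rw [base, Nat.mod_eq_of_lt hq]

lemma base_add (J q : ℕ) : T.base J (q + d) = T.base J q := by simp [base]

lemma base_length_pos (J q : ℕ) : 0 < (T.base J q).length := T.len_pos _

/-- A word seen in a bi-infinite sequence made of two half-infinite periodic pieces. -/
def Legal (J : ℕ) (v : List (Fin d)) : Prop :=
  ∃ q, ∃ t : ℤ, v = window (jointSeq (T.base J q) (T.base J (q + 1))) t v.length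

lemma legal_of_periodicSeq {J q : ℕ} {t : ℤ} {v : List (Fin d)}
    (h : v = window (periodicSeq (T.base J q)) t v.length) : T.Legal J v := by
  have hpos := T.base_length_pos J q
  set L := (T.base J q).length
  -- Since `L ≥ 1`, moving left by `v.length + 1` periods places the whole window before the joint.
  refine ⟨q, t % L + L * (-(v.length + 1 : ℤ)), ?_⟩
  conv_lhs => rw [h, ← window_periodicSeq_emod, ← window_periodicSeq_add_mul _ _ (-(v.length + 1 : ℤ))]
  rw [window_eq_window_iff]
  intro k hk
  rw [jointSeq_of_neg]
  have h1 := Int.emod_lt_of_pos t (show (0 : ℤ) < L by omega)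
  have h2 : (L : ℤ) * (v.length + 1) = L * v.length + L := by ring
  have h3 : (v.length : ℤ) ≤ L * v.length := by
    exact_mod_cast Nat.le_mul_of_pos_left _ hpos
  have h4 : (k : ℤ) < v.length := by exact_mod_cast hk
  linarith

/-- `z` looks legal at scale `n`, starts like the base word `q` and ends like the base
word `q'`. -/
structure Good (J n q q' : ℕ) (z : List (Fin d)) : Prop where
  le_length : n ≤ z.length
  legal : ∀ v, v <:+: z → v.length ≤ n → T.Legal J v
  isPrefix : ∀ v, v <+: z → v.length ≤ n → v = window (periodicSeq (T.base J q)) 0 v.length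
  isSuffix : ∀ v, v <:+ z → v.length ≤ n →
    v = window (periodicSeq (T.base J q')) (-v.length) v.length

variable {T}

/-- A short word straddling the junction splits into a suffix of `z` and a prefix of `z'`, each in
its periodic regime. If the base words agree the period continues; if they are consecutive, a single
joint appears. -/
lemma Good.append {J n q q' r r' : ℕ} {z z' : List (Fin d)} (hz : T.Good J n q q' z)
    (hz' : T.Good J n r r' z') (h : T.base J r = T.base J q' ∨ T.base J r = T.base J (q' + 1)) :
    T.Good J n q r' (z ++ z') where
  le_length := by rw [List.length_append]; exact hz.le_length.trans (Nat.le_add_right _ _)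
  legal v hv hn := by
    rcases List.infix_append_iff.1 hv with h1 | h1 | ⟨s, p, rfl, hs, hp⟩
    · exact hz.legal v h1 hn
    · exact hz'.legal v h1 hn
    · rw [List.length_append] at hn
      have hs' := hz.isSuffix s hs (by omega)
      have hp' := hz'.isPrefix p hp (by omega)
      rcases h with h | h
      · refine T.legal_of_periodicSeq (q := q') (t := -s.length) ?_
        rw [List.length_append, window_add, ← hs']
        congr 1
        rw [h] at hp'
        simpa using hp'
      · refine ⟨q', -s.length, ?_⟩
        rw [List.length_append, window_add]
        congr 1
        · conv_lhs => rw [hs']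
          rw [window_eq_window_iff]
          intro k hk
          rw [jointSeq_of_neg (by omega)]
        · conv_lhs => rw [hp', h]
          rw [window_eq_window_iff]
          intro k hk
          rw [jointSeq_of_nonneg (by omega)]
          congr 1
          ring
  isPrefix v hv hn :=
    hz.isPrefix v (List.prefix_of_prefix_length_le hv (List.prefix_append _ _)
      (hn.trans hz.le_length)) hn
  isSuffix v hv hn :=
    hz'.isSuffix v (List.suffix_of_suffix_length_le hv (List.suffix_append _ _)
      (hn.trans hz'.le_length)) hn

lemma Good.wordPow {J n q : ℕ} {z : List (Fin d)} (hz : T.Good J n q q z) {k : ℕ} (hk : 0 < k) :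
    T.Good J n q q (wordPow k z) := by
  induction k, hk using Nat.le_induction with
  | base => exact (wordPow_one z).symm ▸ hz
  | succ k hk ih =>
    rw [wordPow_succ]
    exact hz.append ih (Or.inl rfl)

lemma good_wordPow_base {J n q k : ℕ} (h : n ≤ k * (T.base J q).length) :
    T.Good J n q q (wordPow k (T.base J q)) where
  le_length := by simpa using h
  legal v hv _ := by
    rw [← window_periodicSeq_mul_length] at hv
    obtain ⟨s, -, hs⟩ := eq_window_of_isInfix hv
    exact T.legal_of_periodicSeq hs
  isPrefix v hv _ := by
    rw [← window_periodicSeq_mul_length] at hv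
    exact eq_window_of_isPrefix hv
  isSuffix v hv _ := by
    rw [← window_periodicSeq_mul_length] at hv
    have h1 := eq_window_of_isSuffix hv
    rw [← window_periodicSeq_add_mul _ _ k]
    convert h1 using 2
    push_cast
    ring

lemma Good.congr {J n q q' r r' : ℕ} {z : List (Fin d)} (hz : T.Good J n q q' z)
    (h : T.base J q = T.base J r) (h' : T.base J q' = T.base J r') : T.Good J n r r' z where
  le_length := hz.le_length
  legal := hz.legal
  isPrefix := by rw [← h]; exact hz.isPrefix
  isSuffix := by rw [← h']; exact hz.isSuffix

variable (T)

/-- Strong induction along the recursion: every run and every tail from level J on is at least n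
long, and consecutive runs have cyclically consecutive types, so they can be glued one by one. -/
lemma good_wordPow (hd : 1 < d) {J n : ℕ} (hn : n ≤ T.tail J) (q : ℕ) :
    ∀ k, 0 < k → n ≤ k * T.len (J + q) → T.Good J n q q (wordPow k (T.w (J + q))) := by
  induction q using Nat.strong_induction_on with
  | _ q ih =>
    intro k hk hkn
    rcases lt_or_ge q d with h | h
    · rw [← T.base_of_lt J h]
      rw [← T.length_w, ← T.base_of_lt J h] at hkn
      exact good_wordPow_base hkn
    · refine Good.wordPow ?_ hk
      obtain ⟨r, rfl⟩ := Nat.exists_eq_add_of_le' h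
      have htail : n ≤ T.tail (J + r) := hn.trans (T.tail_mono hd (Nat.le_add_right _ _))
      have hrun : ∀ j < d,
          T.Good J n (r + j) (r + j) (wordPow (T.e (J + r) j) (T.w (J + r + j))) := by
        intro j hj
        have h1 := ih (r + j) (by omega) (T.e (J + r) j) (T.e_pos hd _ hj)
        rw [← add_assoc] at h1
        exact h1 (htail.trans (T.tail_le_run hd _ hj))
      have hmid : ∀ i < d, T.Good J n r (r + i) ((List.range (i + 1)).flatMap
          (fun j => wordPow (T.e (J + r) j) (T.w (J + r + j)))) := by
        intro i hi
        induction i with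
        | zero => simpa using hrun 0 hi
        | succ i ihi =>
          rw [List.range_succ, List.flatMap_append]
          refine (ihi (by omega)).append (r := r + (i + 1)) ?_ (Or.inr rfl)
          simpa using hrun (i + 1) hi
      have hlast := ih r (by omega) (T.a (J + r)) (T.a_pos _) htail
      have h2 := hmid (d - 1) (by omega)
      rw [show d - 1 + 1 = d by omega] at h2
      rw [← add_assoc, T.w_rec]
      -- The type after `r + (d - 1)` is `r + d`, which has the same base word as `r`. The closing
      -- block thus completes the cycle and gives both ends the same type, so powers can be formed
      -- at the next level.
      refine (h2.append hlast (Or.inr ?_)).congr (T.base_add J r).symm (T.base_add J r).symm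
      rw [show r + (d - 1) + 1 = r + d by omega, T.base_add]

/-- The words occurring in the tower. -/
def InLang (v : List (Fin d)) : Prop := ∃ m, v <:+: T.w m

lemma InLang.exists_ge (hd : 1 < d) {v : List (Fin d)} (hv : T.InLang v) (N : ℕ) :
    ∃ m, N ≤ m ∧ v <:+: T.w m := by
  obtain ⟨m, hm⟩ := hv
  exact ⟨m + N + d, by omega, hm.trans (T.isInfix_of_le hd (by omega) (by omega))⟩

lemma legal_of_inLang (hd : 1 < d) {J : ℕ} {v : List (Fin d)} (hv : T.InLang v)
    (hn : v.length ≤ T.tail J) : T.Legal J v := by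
  obtain ⟨m, hm, hvm⟩ := InLang.exists_ge T hd hv (J + d)
  obtain ⟨q, rfl⟩ := Nat.exists_eq_add_of_le (show J ≤ m by omega)
  have hlen : T.tail J ≤ T.len (J + q) := by
    have h1 := T.tail_le_run hd J (dim_pos (d := d))
    have h2 := T.run_le_len J (dim_pos (d := d))
    have h3 := T.len_mono hd (show J + d ≤ J + q by omega)
    omega
  have := T.good_wordPow hd hn q 1 one_pos (by omega)
  rw [wordPow_one] at this
  exact this.legal v hvm le_rfl

/-- The subshift generated by a tower of words. -/
def subshift : Subshift (Fin d) ℤ where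
  carrier := {x | ∀ (p : ℤ) (n : ℕ), T.InLang (window x p n)}
  isClosed := by
    simp only [Set.ofPred_forall]
    refine isClosed_iInter fun p => isClosed_iInter fun n => ?_
    have : Continuous fun (x : ℤ → Fin d) (k : Fin n) => x (p + k) := by fun_prop
    exact (isClosed_discrete {u : Fin n → Fin d | T.InLang (List.ofFn u)}).preimage this
  mapsTo g x hx p n := by
    have : window (shift g x) p n = window x (g + p) n := by
      rw [window_eq_window_iff]
      intro k _
      simp [add_assoc]
    rw [this]
    exact hx _ _

end WordTower

/-! ### Points of the subshift realising the words of the tower. -/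

/-- A sequence of words extending each other on both sides converges to a bi-infinite sequence. -/
lemma exists_limit_of_extensions {α : Type*} [Inhabited α] (u A C : ℕ → List α)
    (hu : ∀ k, u (k + 1) = A k ++ u k ++ C k) (hA : ∀ k, A k ≠ []) (hC : ∀ k, C k ≠ []) :
    ∃ x : ℤ → α, window x 0 (u 0).length = u 0 ∧ ∀ (p : ℤ) (n : ℕ), ∃ k, window x p n <:+: u k := by
  -- `o k` is the position of `u 0` inside `u k`; it serves as the common origin.
  set o : ℕ → ℕ := fun k => ∑ i ∈ Finset.range k, (A i).length with ho
  have ho_succ : ∀ k, o (k + 1) = o k + (A k).length := fun k => Finset.sum_range_succ _ _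
  have hA' : ∀ k, 1 ≤ (A k).length := fun k => List.length_pos_iff.2 (hA k)
  have hC' : ∀ k, 1 ≤ (C k).length := fun k => List.length_pos_iff.2 (hC k)
  have hlen : ∀ k, (u (k + 1)).length = (A k).length + (u k).length + (C k).length := by
    intro k; rw [hu]; simp [add_assoc]
  have hok : ∀ k, k ≤ o k := by
    intro k
    induction k with
    | zero => simp
    | succ k ih => rw [ho_succ]; have := hA' k; omega
  have hlk : ∀ k, o k + k ≤ (u k).length := by
    intro k
    induction k with
    | zero => simp [ho]
    | succ k ih => rw [ho_succ, hlen]; have := hC' k; omega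
  have hstep : ∀ k (t : ℤ), -(o k : ℤ) ≤ t → t + o k < (u k).length →
      periodicSeq (u (k + 1)) (t + o (k + 1)) = periodicSeq (u k) (t + o k) := by
    intro k t h1 h2
    rw [ho_succ]
    have h3 : u (k + 1) = A k ++ (u k ++ C k) := by rw [hu, List.append_assoc]
    have h4 := periodicSeq_append_right h3 (t := t + o k) (by omega)
      (by rw [List.length_append]; push_cast; omega)
    rw [periodicSeq_append_left rfl (by omega) h2] at h4
    rw [← h4]
    congr 1
    push_cast
    ring
  have hfar : ∀ k r (t : ℤ), -(o k : ℤ) ≤ t → t + o k < (u k).length →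
      periodicSeq (u (k + r)) (t + o (k + r)) = periodicSeq (u k) (t + o k) := by
    intro k r t h1 h2
    have : -(o (k + r) : ℤ) ≤ t ∧ t + o (k + r) < (u (k + r)).length ∧
        periodicSeq (u (k + r)) (t + o (k + r)) = periodicSeq (u k) (t + o k) := by
      induction r with
      | zero => exact ⟨h1, h2, rfl⟩
      | succ r ih =>
        obtain ⟨i1, i2, i3⟩ := ih
        have e1 := ho_succ (k + r)
        have e2 := hlen (k + r)
        have e3 := hC' (k + r)
        rw [← add_assoc]
        exact ⟨by omega, by omega, (hstep (k + r) t i1 i2).trans i3⟩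
    exact this.2.2
  -- Both margins grow by at least one letter per step, so stage `t.natAbs + 1` already covers
  -- position `t`.
  set x : ℤ → α := fun t => periodicSeq (u (t.natAbs + 1)) (t + o (t.natAbs + 1)) with hx
  have hval : ∀ k (t : ℤ), -(o k : ℤ) ≤ t → t + o k < (u k).length →
      x t = periodicSeq (u k) (t + o k) := by
    intro k t h1 h2
    have h3 := hok (t.natAbs + 1)
    have h4 := hlk (t.natAbs + 1)
    rcases le_total k (t.natAbs + 1) with h | h
    · obtain ⟨r, hr⟩ := Nat.exists_eq_add_of_le h
      rw [hx]
      dsimp only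
      rw [hr]
      exact hfar k r t h1 h2
    · obtain ⟨r, rfl⟩ := Nat.exists_eq_add_of_le h
      exact (hfar _ r t (by omega) (by omega)).symm
  have hwin : ∀ k, window x (-o k) (u k).length = u k := by
    intro k
    conv_rhs => rw [← window_periodicSeq_length (u k)]
    rw [window_eq_window_iff]
    intro i hi
    rw [hval k _ (by omega) (by omega)]
    congr 1
    ring
  refine ⟨x, by simpa [ho] using hwin 0, fun p n => ⟨p.natAbs + n, ?_⟩⟩
  rw [← hwin (p.natAbs + n)]
  have h3 := hok (p.natAbs + n)
  have h4 := hlk (p.natAbs + n)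
  exact window_isInfix_of_le x (by omega) (by omega)

namespace WordTower

variable {d : ℕ} [NeZero d] (T : WordTower d)

lemma exists_mem_window_eq_w (hd : 1 < d) (m : ℕ) :
    ∃ x ∈ T.subshift.carrier, window x 0 (T.len m) = T.w m := by
  have hsplit : ∀ k, ∃ A C : List (Fin d), T.w (k + d) = A ++ T.w k ++ C ∧ A ≠ [] ∧ C ≠ [] := by
    intro k
    obtain ⟨A, B, hA, h⟩ := T.exists_run_split k dim_pos
    obtain ⟨r, hr⟩ := Nat.exists_eq_add_of_le' (T.e_zero_ge_two hd k)
    obtain ⟨A', hA', h'⟩ := T.exists_tail_split k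
    have hA0 : A = [] := by simpa using hA
    have hne : T.w k ≠ [] := List.length_pos_iff.1 (T.len_pos k)
    -- The second copy of `T.w k` in the first run is chosen, so that there is something on its
    -- left.
    refine ⟨T.w k, wordPow r (T.w k) ++ B, ?_, hne, ?_⟩
    · rw [h, hr, hA0, wordPow_succ, wordPow_succ]
      simp
    · intro h0
      obtain ⟨h1, h2⟩ := List.append_eq_nil_iff.1 h0
      have h3 : T.len (k + d) = T.run k 0 := by
        rw [len, h, hA0, h2]
        simp [run, len]
      have h4 := T.len_add k
      have h5 := T.tail_pos k
      have h6 := Finset.single_le_sum (f := fun j => T.run k j) (fun _ _ => Nat.zero_le _)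
        (Finset.mem_range.2 (dim_pos (d := d)))
      omega
  choose A C h hA hC using hsplit
  obtain ⟨x, hx0, hx⟩ := exists_limit_of_extensions (fun k => T.w (m + k * d))
    (fun k => A (m + k * d)) (fun k => C (m + k * d))
    (fun k => by rw [← h]; congr 1; ring) (fun k => hA _) (fun k => hC _)
  refine ⟨x, fun p n => ?_, by simpa [len] using hx0⟩
  obtain ⟨k, hk⟩ := hx p n
  exact ⟨_, hk⟩

lemma exists_mem_window_eq (hd : 1 < d) {v : List (Fin d)} (hv : T.InLang v) :
    ∃ x ∈ T.subshift.carrier, ∃ p : ℤ, window x p v.length = v := by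
  obtain ⟨m, hm⟩ := hv
  obtain ⟨x, hx, hw⟩ := T.exists_mem_window_eq_w hd m
  rw [← hw] at hm
  obtain ⟨s, -, hs⟩ := eq_window_of_isInfix hm
  exact ⟨x, hx, _, hs.symm⟩

end WordTower

/-! ### Right special words and lower bounds for the complexity. -/

namespace WordTower

variable {d : ℕ} [NeZero d] (T : WordTower d)

/-- The words of length `n` in the language of the tower. -/
def lang (n : ℕ) : Set (List (Fin d)) := {v | v.length = n ∧ T.InLang v}

lemma lang_finite (n : ℕ) : (T.lang n).Finite :=
  (List.finite_length_eq (Fin d) n).subset fun _ h => h.1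

lemma complexityFn_subshift (hd : 1 < d) (n : ℕ) :
    complexityFn T.subshift n = (T.lang n).ncard := by
  rw [complexityFn, ← Set.ncard_image_of_injective _ (List.ofFn_injective (n := n))]
  congr 1
  ext v
  constructor
  · rintro ⟨u, ⟨x, hx, m, hu⟩, rfl⟩
    refine ⟨by simp, ?_⟩
    obtain rfl : u = fun i : Fin n => x (m + (i : ℕ)) := funext hu
    exact hx m n
  · rintro ⟨rfl, hv⟩
    obtain ⟨x, hx, p, hp⟩ := T.exists_mem_window_eq hd hv
    exact ⟨fun i => x (p + (i : ℕ)), ⟨x, hx, p, fun _ => rfl⟩, hp⟩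

lemma exists_extension (hd : 1 < d) {v : List (Fin d)} (hv : T.InLang v) :
    ∃ c, T.InLang (v ++ [c]) := by
  obtain ⟨x, hx, p, hp⟩ := T.exists_mem_window_eq hd hv
  refine ⟨x (p + v.length), ?_⟩
  have := hx p (v.length + 1)
  rwa [window_succ, hp] at this

/-- Each right special word contributes to the growth of the complexity. -/
lemma card_lang_succ_ge (hd : 1 < d) {n : ℕ} (S : Finset (List (Fin d)))
    (hS : ∀ v ∈ S, v.length = n ∧ ∃ a b, a ≠ b ∧ T.InLang (v ++ [a]) ∧ T.InLang (v ++ [b])) :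
    (T.lang n).ncard + S.card ≤ (T.lang (n + 1)).ncard := by
  classical
  have hc : ∀ u : List (Fin d), ∃ c, T.InLang u → T.InLang (u ++ [c]) := by
    intro u
    by_cases h : T.InLang u
    · obtain ⟨c, hc⟩ := T.exists_extension hd h
      exact ⟨c, fun _ => hc⟩
    · exact ⟨0, fun h' => absurd h' h⟩
  choose c hc using hc
  have ho : ∀ v : List (Fin d), ∃ o, v ∈ S → o ≠ c v ∧ T.InLang (v ++ [o]) := by
    intro v
    by_cases h : v ∈ S
    · obtain ⟨-, a, b, hab, ha, hb⟩ := hS v h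
      by_cases hac : a = c v
      · exact ⟨b, fun _ => ⟨fun h' => hab (hac.trans h'.symm), hb⟩⟩
      · exact ⟨a, fun _ => ⟨hac, ha⟩⟩
    · exact ⟨0, fun h' => absurd h' h⟩
  choose o ho using ho
  have hinj : ∀ g : List (Fin d) → Fin d, Function.Injective fun u => u ++ [g u] :=
    fun g u v huv => (List.append_inj' huv rfl).1
  -- Every word is extended by `c`, and every right special word also by some `o ≠ c`; the two
  -- families of extensions cannot meet.
  have hdisj : Disjoint ((T.lang_finite n).toFinset.image fun u => u ++ [c u])
      (S.image fun u => u ++ [o u]) := by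
    rw [Finset.disjoint_left]
    intro v h1 h2
    obtain ⟨u, -, rfl⟩ := Finset.mem_image.1 h1
    obtain ⟨u', hu', h⟩ := Finset.mem_image.1 h2
    obtain ⟨h3, h4⟩ := List.append_inj' h rfl
    subst h3
    exact (ho u' hu').1 (by simpa using h4)
  rw [Set.ncard_eq_toFinset_card _ (T.lang_finite n),
    Set.ncard_eq_toFinset_card _ (T.lang_finite (n + 1)),
    ← Finset.card_image_of_injective _ (hinj c), ← Finset.card_image_of_injective S (hinj o),
    ← Finset.card_union_of_disjoint hdisj]
  apply Finset.card_le_card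
  intro v hv
  rw [Set.Finite.mem_toFinset]
  rcases Finset.mem_union.1 hv with h | h
  · obtain ⟨u, hu, rfl⟩ := Finset.mem_image.1 h
    rw [Set.Finite.mem_toFinset] at hu
    exact ⟨by simp [hu.1], hc u hu.2⟩
  · obtain ⟨u, hu, rfl⟩ := Finset.mem_image.1 h
    exact ⟨by simp [(hS u hu).1], (ho u hu).2⟩

lemma inLang_window_periodicSeq (k : ℕ) {t : ℤ} {n : ℕ} (h0 : 0 ≤ t) (h1 : t + n ≤ T.run k 0) :
    T.InLang (window (periodicSeq (T.w k)) t n) := by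
  refine ⟨k + d, ?_⟩
  have h2 := T.run_le_len k (dim_pos (d := d))
  rw [← window_periodicSeq_length (T.w (k + d)), T.length_w]
  convert window_isInfix_of_le (periodicSeq (T.w (k + d))) h0 (m := n) (n := T.len (k + d))
    (by omega) using 1
  rw [window_eq_window_iff]
  intro i hi
  rw [T.periodicSeq_merged k (by omega) (by omega)]

/-- The suffix of length `n` of the left-infinite periodic word `…(T.w m)(T.w m)`. -/
def special (m n : ℕ) : List (Fin d) := window (periodicSeq (T.w m)) (-n) n

lemma inLang_special_self (hd : 1 < d) {m n : ℕ} (hn : n ≤ T.run m 0) :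
    T.InLang (T.special m n ++ [Fin.ofNat d m]) := by
  have hlen := T.len_add m
  have h1 := T.run_le_len m (dim_pos (d := d))
  have h2 := T.len_le_tail m
  have h3 := T.len_mono hd (show m ≤ m + d - 1 by omega)
  have h4 := T.len_pos m
  have h5 : 2 * T.len (m + d) ≤ T.run (m + d) 0 :=
    Nat.mul_le_mul_right _ (T.e_zero_ge_two hd (m + d))
  have h6 : T.tail m ≤ T.len (m + d) := by omega
  -- The window ends at the first letter of the last copy of `T.w m` in a first run. For `n` near
  -- `T.run m 0` it starts in the merged tail of the preceding period, so one works in the second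
  -- copy of `T.w (m + d)`.
  have key := T.inLang_window_periodicSeq (m + d) (t := T.run m 0 - T.len m - n + T.len (m + d))
    (n := n + 1) (by omega) (by push_cast; omega)
  convert key using 1
  have h7 := (T.periodicSeq_zero_neg_one hd m).1
  rw [special, ← h7]
  have h8 : window (periodicSeq (T.w m)) (-n) n ++ [periodicSeq (T.w m) 0] =
      window (periodicSeq (T.w m)) (-n) (n + 1) := by
    rw [window_succ]; simp
  have h9 := window_periodicSeq_add_mul (T.w (m + d)) (T.run m 0 - T.len m - n) 1 (n + 1)
  rw [mul_one, T.length_w] at h9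
  rw [h8, h9, ← window_periodicSeq_add_mul _ _ (T.e m 0 - 1), window_eq_window_iff]
  intro k hk
  have h10 : ((T.w m).length : ℤ) * (T.e m 0 - 1) = T.run m 0 - T.len m := by
    rw [T.length_w, run, add_zero]; push_cast; ring
  rw [h10, T.periodicSeq_merged m (by omega) (by omega)]
  congr 1
  ring

/-- The last `n` letters of the first run in `T.w (m + d)` are followed by the beginning of `T.w (m
+ 1)`. -/
lemma inLang_special_succ (hd : 1 < d) {m n : ℕ} (hn : n ≤ T.run m 0) :
    T.InLang (T.special m n ++ [Fin.ofNat d (m + 1)]) := by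
  have h1 := T.tail_le_run hd m hd
  have h2 := T.tail_pos m
  have h3 : T.run m 0 + T.run m 1 ≤ T.len (m + d) := by
    rw [T.len_add]
    have := Finset.sum_le_sum_of_subset (f := fun j => T.run m j)
      (Finset.range_mono (show 2 ≤ d from hd))
    rw [Finset.sum_range_succ, Finset.sum_range_one] at this
    omega
  have h4 : T.special m n ++ [Fin.ofNat d (m + 1)] =
      window (periodicSeq (T.w (m + d))) (T.run m 0 - n) (n + 1) := by
    rw [window_succ, special]
    congr 1
    · rw [← window_periodicSeq_add_mul _ _ (T.e m 0), window_eq_window_iff]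
      intro k hk
      rw [T.periodicSeq_merged m (by omega) (by omega)]
      congr 1
      rw [T.length_w, run, add_zero]; push_cast; ring
    · have := T.periodicSeq_run m hd (t := 0) le_rfl (by omega)
      rw [Finset.sum_range_one, (T.periodicSeq_zero_neg_one hd (m + 1)).1] at this
      rw [← this]
      simp
  refine ⟨m + d, ?_⟩
  rw [h4]
  conv_rhs => rw [← window_periodicSeq_length (T.w (m + d)), T.length_w]
  exact window_isInfix_of_le _ (by omega) (by push_cast; omega)

lemma ofNat_eq_iff {m m' : ℕ} : Fin.ofNat d m = Fin.ofNat d m' ↔ m % d = m' % d := by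
  rw [Fin.ext_iff]; simp

lemma special_spec (hd : 1 < d) {m n : ℕ} (hn : n ≤ T.run m 0) : (T.special m n).length = n ∧
    ∃ a b, a ≠ b ∧ T.InLang (T.special m n ++ [a]) ∧ T.InLang (T.special m n ++ [b]) := by
  refine ⟨by simp [special], _, _, ?_, T.inLang_special_self hd hn, T.inLang_special_succ hd hn⟩
  rw [Ne, ofNat_eq_iff]
  intro h
  have h1 : m + 0 ≡ m + 1 [MOD d] := h
  have h2 := Nat.ModEq.add_left_cancel' m h1
  rw [Nat.ModEq, Nat.mod_eq_of_lt hd, Nat.zero_mod] at h2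
  omega

lemma mod_eq_of_special_eq (hd : 1 < d) {m m' n : ℕ} (hn : 0 < n)
    (h : T.special m n = T.special m' n) : m % d = m' % d := by
  rw [special, special, window_eq_window_iff] at h
  have h1 := h (n - 1) (by omega)
  rw [show -(n : ℤ) + ((n - 1 : ℕ) : ℤ) = -1 by omega,
    (T.periodicSeq_zero_neg_one hd m).2, (T.periodicSeq_zero_neg_one hd m').2, ofNat_eq_iff] at h1
  exact h1

/-- The two suffixes agree along the tail and part just before it: one continues with the last
letter of `T.w m`, the other with the last letter of run `d - 1`, and these letters have different
residues. -/
lemma special_ne_special_add (hd : 1 < d) {m n : ℕ} (hn : T.tail m < n) :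
    T.special m n ≠ T.special (m + d) n := by
  intro h
  rw [special, special, window_eq_window_iff] at h
  have h1 := h (n - 1 - T.tail m) (by omega)
  rw [show -(n : ℤ) + ((n - 1 - T.tail m : ℕ) : ℤ) = -1 - T.tail m by omega] at h1
  have h2 : periodicSeq (T.w m) (-1 - T.tail m) = Fin.ofNat d m := by
    rw [← (T.periodicSeq_zero_neg_one hd m).2, ← periodicSeq_add_mul _ _ (T.a m)]
    congr 1
    rw [T.length_w, tail]; push_cast; ring
  have h3 : periodicSeq (T.w (m + d)) (-1 - T.tail m) = Fin.ofNat d (m + (d - 1)) := by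
    have h4 := T.tail_le_run hd m (show d - 1 < d by omega)
    have h5 := T.tail_pos m
    rw [← (T.periodicSeq_zero_neg_one hd (m + (d - 1))).2,
      ← periodicSeq_add_mul _ (-1) (T.e m (d - 1))]
    have h6 := T.periodicSeq_run m (show d - 1 < d by omega) (t := T.run m (d - 1) - 1)
      (by omega) (by omega)
    have h7 : (T.w (m + (d - 1))).length * (T.e m (d - 1) : ℤ) = T.run m (d - 1) := by
      rw [T.length_w, run]; push_cast; ring
    rw [h7, show -1 + (T.run m (d - 1) : ℤ) = T.run m (d - 1) - 1 by ring, ← h6,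
      ← periodicSeq_add_mul _ (-1 - T.tail m) 1, T.length_w, T.len_add]
    congr 1
    have h8 := Finset.sum_range_succ (fun j => T.run m j) (d - 1)
    rw [Nat.sub_add_cancel (dim_pos (d := d))] at h8
    rw [h8]
    push_cast
    ring
  rw [h2, h3, ofNat_eq_iff] at h1
  have h4 : m + 0 ≡ m + (d - 1) [MOD d] := h1
  have h5 := Nat.ModEq.add_left_cancel' m h4
  rw [Nat.ModEq, Nat.mod_eq_of_lt (show d - 1 < d by omega), Nat.zero_mod] at h5
  omega

lemma eq_of_mod_eq_of_lt {d m i j : ℕ} (hi : i < d) (hj : j < d) (h : (m + i) % d = (m + j) % d) :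
    i = j := by
  have h1 : m + i ≡ m + j [MOD d] := h
  have h2 := Nat.ModEq.add_left_cancel' m h1
  rwa [Nat.ModEq, Nat.mod_eq_of_lt hi, Nat.mod_eq_of_lt hj] at h2

lemma card_lang_add_dim_le (hd : 1 < d) {n : ℕ} (hn : 0 < n) :
    (T.lang n).ncard + d ≤ (T.lang (n + 1)).ncard := by
  have hrun : ∀ i, n ≤ T.run (n + i) 0 := fun i =>
    ((Nat.le_add_right n i).trans (T.le_tail_self _)).trans (T.tail_le_run hd _ dim_pos)
  classical
  have := T.card_lang_succ_ge hd (n := n)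
    -- Any d consecutive levels have distinct residues; starting at level `n` guarantees `n ≤ T.run
    -- (n + i) 0`.
    ((Finset.range d).image fun i => T.special (n + i) n) (by
      intro v hv
      obtain ⟨i, -, rfl⟩ := Finset.mem_image.1 hv
      exact T.special_spec hd (hrun i))
  rwa [Finset.card_image_of_injOn, Finset.card_range] at this
  intro i hi j hj hij
  exact eq_of_mod_eq_of_lt (by simpa using hi) (by simpa using hj)
    (T.mod_eq_of_special_eq hd hn hij)

lemma card_lang_add_dim_succ_le (hd : 1 < d) {m n : ℕ} (h1 : T.tail m < n) (h2 : n ≤ T.run m 0) :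
    (T.lang n).ncard + (d + 1) ≤ (T.lang (n + 1)).ncard := by
  have hrun : ∀ i, n ≤ T.run (m + i) 0 := fun i =>
    h2.trans (T.run_zero_mono hd (Nat.le_add_right m i))
  have hn : 0 < n := by omega
  classical
  have := T.card_lang_succ_ge hd (n := n)
    ((Finset.range (d + 1)).image fun i => T.special (m + i) n) (by
      intro v hv
      obtain ⟨i, -, rfl⟩ := Finset.mem_image.1 hv
      exact T.special_spec hd (hrun i))
  rwa [Finset.card_image_of_injOn, Finset.card_range] at this
  -- Among `d + 1` consecutive levels only `m` and `m + d` share a residue, and those two suffixes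
  -- differ because `n` exceeds the tail.
  have aux : ∀ i < d, T.special (m + i) n ≠ T.special (m + d) n := by
    intro i hi h
    have h3 := T.mod_eq_of_special_eq hd hn h
    rw [Nat.add_mod_right] at h3
    obtain rfl : i = 0 := eq_of_mod_eq_of_lt hi dim_pos h3
    exact T.special_ne_special_add hd h1 h
  intro i hi j hj hij
  simp only [Finset.coe_range, Set.mem_Iio, Nat.lt_succ_iff] at hi hj
  dsimp only at hij
  rcases hi.lt_or_eq with hi' | rfl <;> rcases hj.lt_or_eq with hj' | rfl
  · exact eq_of_mod_eq_of_lt hi' hj' (T.mod_eq_of_special_eq hd hn hij)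
  · exact absurd hij (aux i hi')
  · exact absurd hij.symm (aux j hj')
  · rfl

lemma dim_mul_le_card_lang (hd : 1 < d) (n : ℕ) : d * n ≤ (T.lang n).ncard := by
  rcases Nat.eq_zero_or_pos n with rfl | hn
  · simp
  induction n, hn using Nat.le_induction with
  | base =>
    have hsub : Set.range (fun i : Fin d => [i]) ⊆ T.lang 1 := by
      rintro _ ⟨i, rfl⟩
      refine ⟨rfl, i, ?_⟩
      rw [T.w_init i i.2]
      simp
    have h := Set.ncard_le_ncard hsub (T.lang_finite 1)
    rw [← Set.image_univ, Set.ncard_image_of_injective _ (fun i j h => by simpa using h),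
      Set.ncard_univ, Nat.card_fin] at h
    simpa using h
  | succ n hn ih =>
    have := T.card_lang_add_dim_le hd hn
    rw [mul_add, mul_one]
    omega

lemma dim_succ_mul_le_card_lang (hd : 1 < d) (m : ℕ) :
    (d + 1) * (T.run m 0 - T.tail m - 1) ≤ (T.lang (T.run m 0)).ncard := by
  have h : ∀ r, T.tail m + 1 + r ≤ T.run m 0 →
      (d + 1) * r ≤ (T.lang (T.tail m + 1 + r)).ncard := by
    intro r
    induction r with
    | zero => simp
    | succ r ih =>
      intro hr
      have h1 := ih (by omega)
      have h2 := T.card_lang_add_dim_succ_le hd (m := m) (n := T.tail m + 1 + r)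
        (by omega) (by omega)
      rw [mul_add, mul_one]
      rw [show T.tail m + 1 + (r + 1) = T.tail m + 1 + r + 1 from rfl]
      omega
  rcases le_or_gt (T.tail m + 1) (T.run m 0) with h1 | h1
  · obtain ⟨r, hr⟩ := Nat.exists_eq_add_of_le h1
    have := h r (by omega)
    rw [← hr] at this
    convert this using 2
    omega
  · rw [show T.run m 0 - T.tail m - 1 = 0 by omega]
    simp

end WordTower

/-! ### Upper bounds for the complexity. -/

/-- The windows of length `n` of `z` starting in `S`. -/
def windowsIn {α : Type*} [DecidableEq α] (z : ℤ → α) (n : ℕ) (S : Finset ℤ) : Finset (List α) :=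
  S.image fun t => window z t n

lemma card_windowsIn_le {α : Type*} [DecidableEq α] (z : ℤ → α) (n : ℕ) (S : Finset ℤ) :
    (windowsIn z n S).card ≤ S.card := Finset.card_image_le

lemma mem_windowsIn {α : Type*} [DecidableEq α] {z : ℤ → α} {n : ℕ} {S : Finset ℤ} {v : List α} :
    v ∈ windowsIn z n S ↔ ∃ t ∈ S, window z t n = v := Finset.mem_image

lemma window_periodicSeq_mem {α : Type*} [DecidableEq α] [Inhabited α] {w : List α}
    (hw : 0 < w.length) (t : ℤ) (n : ℕ) :
    window (periodicSeq w) t n ∈ windowsIn (periodicSeq w) n (Finset.Ico 0 (w.length : ℤ)) := by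
  rw [← window_periodicSeq_emod]
  exact mem_windowsIn.2 ⟨_, Finset.mem_Ico.2 ⟨Int.emod_nonneg _ (by omega),
    Int.emod_lt_of_pos _ (by omega)⟩, rfl⟩

lemma window_jointSeq_of_le {α : Type*} [Inhabited α] (w v : List α) {t : ℤ} {n : ℕ}
    (h : t ≤ -n) : window (jointSeq w v) t n = window (periodicSeq w) t n := by
  rw [window_eq_window_iff]
  intro k hk
  rw [jointSeq_of_neg (by omega)]

lemma window_jointSeq_of_nonneg {α : Type*} [Inhabited α] (w v : List α) {t : ℤ} {n : ℕ}
    (h : 0 ≤ t) : window (jointSeq w v) t n = window (periodicSeq v) t n := by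
  rw [window_eq_window_iff]
  intro k hk
  rw [jointSeq_of_nonneg (by omega)]

lemma exists_index_of_lt_sum (f : ℕ → ℕ) {D : ℕ} {t : ℤ} (h0 : 0 ≤ t)
    (h1 : t < (∑ i ∈ Finset.range D, f i : ℕ)) :
    ∃ j < D, ((∑ i ∈ Finset.range j, f i : ℕ) : ℤ) ≤ t ∧
      t < (∑ i ∈ Finset.range (j + 1), f i : ℕ) := by
  induction D with
  | zero => simp at h1; omega
  | succ D ih =>
    rcases lt_or_ge t ((∑ i ∈ Finset.range D, f i : ℕ) : ℤ) with h | h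
    · obtain ⟨j, hj, h2⟩ := ih h
      exact ⟨j, by omega, h2⟩
    · exact ⟨D, by omega, h, h1⟩

namespace WordTower

variable {d : ℕ} [NeZero d] (T : WordTower d)

/-- Words that contain the transition between two consecutive base words. -/
noncomputable def transitionWords (J n q : ℕ) : Finset (List (Fin d)) :=
  windowsIn (jointSeq (T.base J q) (T.base J (q + 1))) n (Finset.Ioo (-(n : ℤ)) 0)

/-- Words that occur in a periodic base word. -/
noncomputable def periodicWords (m n : ℕ) : Finset (List (Fin d)) :=
  windowsIn (periodicSeq (T.w m)) n (Finset.Ico 0 (T.len m : ℤ))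

lemma card_transitionWords_le (J n q : ℕ) : (T.transitionWords J n q).card ≤ n :=
  (card_windowsIn_le _ _ _).trans (by simp)

lemma card_periodicWords_le (m n : ℕ) : (T.periodicWords m n).card ≤ T.len m :=
  (card_windowsIn_le _ _ _).trans (by simp)

lemma window_mem_periodicWords (m n : ℕ) (t : ℤ) :
    window (periodicSeq (T.w m)) t n ∈ T.periodicWords m n :=
  window_periodicSeq_mem (T.len_pos m) t n

lemma mem_of_legal {J n : ℕ} {v : List (Fin d)} (hv : T.Legal J v) (hn : v.length = n) :
    ∃ q < d, v ∈ T.transitionWords J n q ∨ v ∈ T.periodicWords (J + q) n := by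
  subst hn
  obtain ⟨q, t, h⟩ := hv
  have hb : ∀ q, T.base J (q % d) = T.base J q := fun q => by simp [base]
  rcases le_or_gt t (-v.length) with h1 | h1
  · refine ⟨q % d, Nat.mod_lt _ dim_pos, Or.inr ?_⟩
    rw [window_jointSeq_of_le _ _ h1] at h
    rw [h, length_window]
    exact T.window_mem_periodicWords _ _ t
  rcases lt_or_ge t 0 with h2 | h2
  · refine ⟨q % d, Nat.mod_lt _ dim_pos, Or.inl ?_⟩
    rw [transitionWords, hb, show T.base J (q % d + 1) = T.base J (q + 1) by simp [base]]
    exact mem_windowsIn.2 ⟨t, Finset.mem_Ioo.2 ⟨h1, h2⟩, h.symm⟩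
  · refine ⟨(q + 1) % d, Nat.mod_lt _ dim_pos, Or.inr ?_⟩
    rw [window_jointSeq_of_nonneg _ _ h2] at h
    rw [h, length_window]
    exact T.window_mem_periodicWords _ _ t

lemma card_lang_le_of_subset {n : ℕ} (F : Finset (List (Fin d))) (h : T.lang n ⊆ F) :
    (T.lang n).ncard ≤ F.card := by
  rw [← Set.ncard_coe_finset]
  exact Set.ncard_le_ncard h F.finite_toSet

/-- Each of the d transitions is crossed by fewer than `n` windows, and all other words come from
one of the d periodic sequences. -/
lemma card_lang_le (hd : 1 < d) {J n : ℕ} (hn : n ≤ T.tail J) :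
    (T.lang n).ncard ≤ d * n + ∑ q ∈ Finset.range d, T.len (J + q) := by
  refine (T.card_lang_le_of_subset ((Finset.range d).biUnion (T.transitionWords J n) ∪
    (Finset.range d).biUnion fun q => T.periodicWords (J + q) n) ?_).trans ?_
  · rintro v ⟨hvn, hv⟩
    obtain ⟨q, hq, h⟩ := T.mem_of_legal (T.legal_of_inLang hd hv (hvn.trans_le hn)) hvn
    rw [Finset.mem_coe, Finset.mem_union, Finset.mem_biUnion, Finset.mem_biUnion]
    exact h.imp (fun h => ⟨q, Finset.mem_range.2 hq, h⟩) fun h => ⟨q, Finset.mem_range.2 hq, h⟩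
  · refine (Finset.card_union_le _ _).trans (add_le_add ?_ ?_)
    · refine Finset.card_biUnion_le.trans ((Finset.sum_le_card_nsmul _ _ n fun q _ =>
        T.card_transitionWords_le J n q).trans (by simp))
    · exact Finset.card_biUnion_le.trans
        (Finset.sum_le_sum fun q _ => T.card_periodicWords_le _ _)

/-- The length of the run that follows the `j`-th run in a periodic repetition of
`T.w (m + d)`, or a lower bound for it. -/
def nextRun (m j : ℕ) : ℕ := if j + 1 < d then T.run m (j + 1) else T.run m 0

lemma periodicSeq_after_run (m : ℕ) {j : ℕ} (hj : j < d) {t : ℤ} (h0 : 0 ≤ t)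
    (h1 : t < T.nextRun m j) :
    periodicSeq (T.w (m + d)) ((∑ i ∈ Finset.range (j + 1), T.run m i : ℕ) + t) =
      periodicSeq (T.w (m + (j + 1))) t := by
  rw [nextRun] at h1
  split_ifs at h1 with h
  · exact T.periodicSeq_run m h h0 h1
  -- After the last run comes the tail and then the next period, whose first run merges with it.
  -- Counting only `T.run m 0` letters, as in `nextRun`, is enough.
  · obtain rfl : j + 1 = d := by omega
    have h2 := T.len_add m
    rw [T.periodicSeq_merged m (by omega) h1, ← periodicSeq_add_mul _ _ (-1), T.length_w, h2]
    have h3 := T.periodicSeq_merged m (t := t - T.tail m) (by omega) (by omega)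
    have h4 : ((∑ i ∈ Finset.range (j + 1), T.run m i : ℕ) : ℤ) + t +
        ((∑ i ∈ Finset.range (j + 1), T.run m i + T.tail m : ℕ) : ℤ) * -1 = t - T.tail m := by
      push_cast; ring
    rw [h4, h3, ← periodicSeq_add_mul _ t (-T.a m)]
    congr 1
    rw [T.length_w, tail]; push_cast; ring

lemma window_run_eq_window_jointSeq (m n : ℕ) {j : ℕ} (hj : j < d) (hn : n ≤ T.nextRun m j)
    {t : ℤ} (h0 : ((∑ i ∈ Finset.range j, T.run m i : ℕ) : ℤ) ≤ t)
    (h1 : t < (∑ i ∈ Finset.range (j + 1), T.run m i : ℕ)) :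
    window (periodicSeq (T.w (m + d))) t n =
      window (jointSeq (T.w (m + j)) (T.w (m + (j + 1))))
        (t - (∑ i ∈ Finset.range (j + 1), T.run m i : ℕ)) n := by
  rw [window_eq_window_iff]
  intro k hk
  have hs := Finset.sum_range_succ (fun i => T.run m i) j
  set b := ∑ i ∈ Finset.range j, T.run m i
  set b' := ∑ i ∈ Finset.range (j + 1), T.run m i
  rcases lt_or_ge (t + k) b' with h | h
  · rw [jointSeq_of_neg (by omega)]
    have h2 := T.periodicSeq_run m hj (t := t + k - b) (by omega) (by omega)
    rw [show (b : ℤ) + (t + k - b) = t + k by ring] at h2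
    rw [h2, ← periodicSeq_add_mul _ (t - b' + k) (T.e m j)]
    congr 1
    have h3 : ((T.w (m + j)).length * T.e m j : ℤ) = T.run m j := by
      rw [T.length_w, run]; push_cast; ring
    rw [h3, hs]; push_cast; ring
  · rw [jointSeq_of_nonneg (by omega)]
    have h2 := T.periodicSeq_after_run m hj (t := t + k - b') (by omega) (by omega)
    rw [show (b' : ℤ) + (t + k - b') = t + k by ring] at h2
    rw [h2]
    congr 1
    ring

/-- Positions in `T.w (m + d)` inside a run that is followed by a run shorter than `n`. -/
noncomputable def shortRunPositions (m n j : ℕ) : Finset ℤ :=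
  if n ≤ T.nextRun m j then ∅ else
    Finset.Ico ((∑ i ∈ Finset.range j, T.run m i : ℕ) : ℤ)
      (∑ i ∈ Finset.range (j + 1), T.run m i : ℕ)

/-- The last run is followed by at least `T.run m 0 ≥ n` letters of one period. Any earlier run
followed by a run shorter than `n` is itself shorter by the gap factor. -/
lemma gap_mul_card_shortRunPositions_le (m : ℕ) {n j : ℕ} (hj : 1 ≤ j)
    (hn : n ≤ T.run m 0) : scaleGap d m * (T.shortRunPositions m n j).card ≤ n := by
  unfold shortRunPositions
  split_ifs with h
  · simp
  · have h1 : j + 1 < d := by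
      by_contra h2
      rw [nextRun, if_neg h2] at h
      exact h hn
    rw [nextRun, if_pos h1, not_le] at h
    have hs := Finset.sum_range_succ (fun i => T.run m i) j
    rw [Int.card_Ico, hs]
    push_cast
    rw [add_sub_cancel_left, Int.toNat_natCast]
    exact (T.gap_run_le m hj h1).trans h.le

/-- Resolves the periodic words of `T.w (m + d)` into pieces already counted, up to the windows
crossing the end of the first run (fewer than `n`) and the few starting in a run followed by a short
one. -/
lemma mem_of_window_top (m : ℕ) {n : ℕ} (hn : n ≤ T.run m 0) (t : ℤ) :
    window (periodicSeq (T.w (m + d))) t n ∈ T.periodicWords m n ∨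
    window (periodicSeq (T.w (m + d))) t n ∈ windowsIn (periodicSeq (T.w (m + d))) n
      (Finset.Ioo ((T.run m 0 : ℤ) - n) (T.run m 0)) ∨
    ∃ j, 1 ≤ j ∧ j < d ∧
      (window (periodicSeq (T.w (m + d))) t n ∈ windowsIn (periodicSeq (T.w (m + d))) n
        (T.shortRunPositions m n j) ∨
      window (periodicSeq (T.w (m + d))) t n ∈ T.periodicWords (m + j) n ∨
      window (periodicSeq (T.w (m + d))) t n ∈ T.transitionWords (m + 1) n (j - 1)) := by
  rw [← window_periodicSeq_emod, T.length_w]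
  have h0 := Int.emod_nonneg t (b := (T.len (m + d) : ℤ)) (by have := T.len_pos (m + d); omega)
  have h1 := Int.emod_lt_of_pos t (b := (T.len (m + d) : ℤ)) (by have := T.len_pos (m + d); omega)
  set s := t % (T.len (m + d) : ℤ)
  have hlen := T.len_add m
  have merged : ∀ s : ℤ, -(T.tail m : ℤ) ≤ s → s + n ≤ T.run m 0 →
      window (periodicSeq (T.w (m + d))) s n ∈ T.periodicWords m n := by
    intro s hs hsn
    have : window (periodicSeq (T.w (m + d))) s n = window (periodicSeq (T.w m)) s n := by
      rw [window_eq_window_iff]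
      intro k hk
      rw [T.periodicSeq_merged m (by omega) (by omega)]
    rw [this]
    exact T.window_mem_periodicWords m n s
  rcases lt_or_ge s (∑ j ∈ Finset.range d, T.run m j : ℕ) with h2 | h2
  · obtain ⟨j, hj, h3, h4⟩ := exists_index_of_lt_sum (fun j => T.run m j) h0 h2
    rcases Nat.eq_zero_or_pos j with rfl | hj1
    · rw [Finset.sum_range_one] at h4
      rcases le_or_gt (s + n) (T.run m 0) with h5 | h5
      · exact Or.inl (merged s (by omega) h5)
      · exact Or.inr (Or.inl (mem_windowsIn.2 ⟨s, Finset.mem_Ioo.2 ⟨by omega, h4⟩, rfl⟩))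
    · refine Or.inr (Or.inr ⟨j, hj1, hj, ?_⟩)
      by_cases h5 : n ≤ T.nextRun m j
      · right
        rw [T.window_run_eq_window_jointSeq m n hj h5 h3 h4]
        set r : ℤ := s - (∑ i ∈ Finset.range (j + 1), T.run m i : ℕ) with hr
        have hr0 : r < 0 := by omega
        rcases le_or_gt r (-n) with h6 | h6
        · left
          rw [window_jointSeq_of_le _ _ h6]
          exact T.window_mem_periodicWords _ _ _
        · right
          rw [transitionWords, T.base_of_lt _ (show j - 1 < d by omega),
            T.base_of_lt _ (show j - 1 + 1 < d by omega),
            show m + 1 + (j - 1) = m + j by omega,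
            show m + 1 + (j - 1 + 1) = m + (j + 1) by omega]
          exact mem_windowsIn.2 ⟨r, Finset.mem_Ioo.2 ⟨h6, hr0⟩, rfl⟩
      · left
        refine mem_windowsIn.2 ⟨s, ?_, rfl⟩
        rw [shortRunPositions, if_neg h5]
        exact Finset.mem_Ico.2 ⟨h3, h4⟩
  · left
    rw [← window_periodicSeq_add_mul _ s (-1), T.length_w]
    exact merged _ (by omega) (by omega)

/-- At scale `m` legality could fail, since `n` may exceed the tail. At scale `m + 1` it holds, but
the length of `T.w (m + d)` would be too costly; resolving its periodic words replaces that length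
by one extra `n`. -/
lemma card_lang_le_of_le_run (hd : 1 < d) {m n : ℕ} (hn : n ≤ T.run m 0) :
    (T.lang n).ncard ≤ d * n + ∑ j ∈ Finset.range d, T.len (m + j) + n +
      ∑ j ∈ Finset.Ico 1 d, (T.shortRunPositions m n j).card := by
  refine (T.card_lang_le_of_subset ((((Finset.range d).biUnion (T.transitionWords (m + 1) n) ∪
    (Finset.range d).biUnion fun j => T.periodicWords (m + j) n) ∪
    windowsIn (periodicSeq (T.w (m + d))) n (Finset.Ioo ((T.run m 0 : ℤ) - n) (T.run m 0))) ∪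
    (Finset.Ico 1 d).biUnion fun j =>
      windowsIn (periodicSeq (T.w (m + d))) n (T.shortRunPositions m n j)) ?_).trans ?_
  · rintro v ⟨hvn, hv⟩
    obtain ⟨q, hq, h⟩ := T.mem_of_legal (T.legal_of_inLang hd hv
      (hvn.trans_le (hn.trans (T.run_zero_le_tail_succ m)))) hvn
    simp only [Finset.coe_union, Set.mem_union, Finset.mem_coe, Finset.mem_biUnion,
      Finset.mem_range, Finset.mem_Ico]
    rcases h with h | h
    · exact Or.inl (Or.inl (Or.inl ⟨q, hq, h⟩))
    rcases lt_or_ge (q + 1) d with h1 | h1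
    · rw [show m + 1 + q = m + (q + 1) by ring] at h
      exact Or.inl (Or.inl (Or.inr ⟨q + 1, h1, h⟩))
    · rw [show m + 1 + q = m + d by omega] at h
      obtain ⟨t, -, rfl⟩ := mem_windowsIn.1 h
      rcases T.mem_of_window_top m hn t with h2 | h2 | ⟨j, hj1, hjd, h2 | h2 | h2⟩
      · exact Or.inl (Or.inl (Or.inr ⟨0, dim_pos, h2⟩))
      · exact Or.inl (Or.inr h2)
      · exact Or.inr ⟨j, ⟨hj1, hjd⟩, h2⟩
      · exact Or.inl (Or.inl (Or.inr ⟨j, hjd, h2⟩))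
      · exact Or.inl (Or.inl (Or.inl ⟨j - 1, by omega, h2⟩))
  · refine (Finset.card_union_le _ _).trans (add_le_add ((Finset.card_union_le _ _).trans
      (add_le_add ((Finset.card_union_le _ _).trans (add_le_add ?_ ?_)) ?_)) ?_)
    · refine Finset.card_biUnion_le.trans ((Finset.sum_le_card_nsmul _ _ n fun q _ =>
        T.card_transitionWords_le _ n q).trans (by simp))
    · exact Finset.card_biUnion_le.trans
        (Finset.sum_le_sum fun q _ => T.card_periodicWords_le _ _)
    · exact (card_windowsIn_le _ _ _).trans (by simp)
    · exact Finset.card_biUnion_le.trans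
        (Finset.sum_le_sum fun q _ => card_windowsIn_le _ _ _)

lemma gap_mul_sum_len_le (hd : 1 < d) (m : ℕ) :
    scaleGap d m * ∑ j ∈ Finset.range d, T.len (m + j) ≤ d * T.tail m := by
  have h1 := T.gap_sq_le_tail m
  have h2 := one_le_gap (d := d) m
  rw [Finset.mul_sum]
  refine (Finset.sum_le_card_nsmul _ _ (T.tail m) fun j hj => ?_).trans (by simp)
  have h3 := T.len_mono hd (show m + j ≤ m + d - 1 by have := Finset.mem_range.1 hj; omega)
  calc _ ≤ scaleGap d m * T.len (m + d - 1) := Nat.mul_le_mul_left _ h3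
    _ ≤ scaleGap d m * (scaleGap d m * T.len (m + d - 1)) :=
      Nat.mul_le_mul_left _ (Nat.le_mul_of_pos_left _ h2)
    _ ≤ T.tail m := by rw [← mul_assoc, ← sq]; exact h1

lemma gap_mul_card_lang_tail_le (hd : 1 < d) (m : ℕ) :
    scaleGap d m * (T.lang (T.tail m)).ncard ≤ (scaleGap d m * d + d) * T.tail m := by
  have h1 := Nat.mul_le_mul_left (scaleGap d m) (T.card_lang_le hd (le_refl (T.tail m)))
  have h2 := T.gap_mul_sum_len_le hd m
  rw [mul_add] at h1
  rw [add_mul, mul_assoc]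
  omega

lemma gap_mul_card_lang_le (hd : 1 < d) {m n : ℕ} (h1 : T.tail m ≤ n) (h2 : n ≤ T.tail (m + 1)) :
    scaleGap d m * (T.lang n).ncard ≤ (scaleGap d m * (d + 1) + 2 * d) * n := by
  have h3 := T.gap_mul_sum_len_le hd m
  have h4 : d * T.tail m ≤ d * n := Nat.mul_le_mul_left _ h1
  rcases le_total n (T.run m 0) with h | h
  · have h5 := Nat.mul_le_mul_left (scaleGap d m) (T.card_lang_le_of_le_run hd h)
    have h6 : scaleGap d m * ∑ j ∈ Finset.Ico 1 d, (T.shortRunPositions m n j).card ≤ d * n := by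
      rw [Finset.mul_sum]
      refine (Finset.sum_le_card_nsmul _ _ n fun j hj => T.gap_mul_card_shortRunPositions_le m
        (Finset.mem_Ico.1 hj).1 h).trans ?_
      rw [Nat.card_Ico, smul_eq_mul]
      exact Nat.mul_le_mul_right _ (Nat.sub_le _ _)
    simp only [mul_add, add_mul, mul_one] at h5 ⊢
    rw [← mul_assoc] at h5
    rw [mul_assoc 2]
    omega
  -- Beyond the first run no resolution is needed: the length of `T.w (m + d)` is itself at most `n`
  -- up to a small relative error, and accounts for the extra 1 in `d + 1`.
  · have h5 := Nat.mul_le_mul_left (scaleGap d m) (T.card_lang_le hd h2)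
    have h6 : ∑ q ∈ Finset.range d, T.len (m + 1 + q) ≤
        ∑ j ∈ Finset.range d, T.len (m + j) + T.len (m + d) := by
      rw [← Finset.sum_range_succ, Finset.sum_range_succ']
      refine (Nat.le_add_right _ _).trans_eq' ?_
      exact Finset.sum_congr rfl fun q _ => by congr 1; ring
    have h7 := T.len_add_le m hd
    have h8 : scaleGap d m * T.len (m + d) ≤ scaleGap d m * n + d * n := by
      have h9 := T.run_le_len m (dim_pos (d := d))
      have h10 : T.len (m + d) = (T.len (m + d) - T.run m 0) + T.run m 0 := by omega
      rw [h10, mul_add, add_comm]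
      refine add_le_add (Nat.mul_le_mul_left _ h) ?_
      rw [scaleGap, mul_assoc]
      exact Nat.mul_le_mul_left _ (h7.trans h)
    have h11 := Nat.mul_le_mul_left (scaleGap d m) h6
    simp only [mul_add, add_mul, mul_one] at h5 h11 ⊢
    rw [← mul_assoc] at h5
    rw [mul_assoc 2]
    omega

lemma exists_tail_le {M n : ℕ} (hn : T.tail M ≤ n) :
    ∃ m, M ≤ m ∧ T.tail m ≤ n ∧ n ≤ T.tail (m + 1) := by
  have h : ∃ m, M < m ∧ n < T.tail m := by
    refine ⟨M + n + 1, by omega, ?_⟩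
    have := T.le_tail_self (M + n + 1)
    omega
  classical
  obtain ⟨h1, h2⟩ := Nat.find_spec h
  refine ⟨Nat.find h - 1, by omega, ?_, ?_⟩
  · by_contra h3
    rcases Nat.lt_or_ge M (Nat.find h - 1) with h4 | h4
    · exact Nat.find_min h (m := Nat.find h - 1) (by omega) ⟨h4, by omega⟩
    · rw [show Nat.find h - 1 = M by omega] at h3
      exact h3 hn
  · rw [Nat.sub_add_cancel (by omega)]
    exact h2.le

/-! ### The lower and upper limits of the complexity ratio. -/

lemma scaleGap_mono {d m m' : ℕ} (h : m ≤ m') : scaleGap d m ≤ scaleGap d m' :=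
  Nat.mul_le_mul_left _ (Nat.pow_le_pow_right (by norm_num) (by omega))

lemma complexityFn_div_le (hd : 1 < d) {M n : ℕ} (hn : T.tail M ≤ n) :
    (complexityFn T.subshift n : ℝ) / n ≤ d + 1 + 2 * d / scaleGap d M := by
  obtain ⟨m, hm, h1, h2⟩ := T.exists_tail_le hn
  have h3 := T.gap_mul_card_lang_le hd h1 h2
  have h4 : (0 : ℝ) < n := by exact_mod_cast (T.tail_pos M).trans_le hn
  have h5 : (0 : ℝ) < scaleGap d m := by exact_mod_cast scaleGap_pos (d := d) m
  have h6 : (0 : ℝ) < scaleGap d M := by exact_mod_cast scaleGap_pos (d := d) M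
  have h7 : (scaleGap d M : ℝ) ≤ scaleGap d m := by exact_mod_cast scaleGap_mono hm
  rw [T.complexityFn_subshift hd]
  have h8 : (scaleGap d m : ℝ) * (T.lang n).ncard ≤ (scaleGap d m * (d + 1) + 2 * d) * n := by
    exact_mod_cast h3
  calc ((T.lang n).ncard : ℝ) / n ≤ d + 1 + 2 * d / scaleGap d m := by
        rw [div_le_iff₀ h4, ← mul_le_mul_iff_right₀ h5]
        refine h8.trans_eq ?_
        field_simp
    _ ≤ _ := by gcongr

lemma complexityFn_tail_div_le (hd : 1 < d) (m : ℕ) :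
    (complexityFn T.subshift (T.tail m) : ℝ) / T.tail m ≤ d + d / scaleGap d m := by
  have h3 := T.gap_mul_card_lang_tail_le hd m
  have h4 : (0 : ℝ) < T.tail m := by exact_mod_cast T.tail_pos m
  have h5 : (0 : ℝ) < scaleGap d m := by exact_mod_cast scaleGap_pos (d := d) m
  rw [T.complexityFn_subshift hd]
  have h8 : (scaleGap d m : ℝ) * (T.lang (T.tail m)).ncard ≤
      (scaleGap d m * d + d) * T.tail m := by exact_mod_cast h3
  rw [div_le_iff₀ h4, ← mul_le_mul_iff_right₀ h5]
  refine h8.trans_eq ?_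
  field_simp

lemma le_complexityFn_div (hd : 1 < d) {n : ℕ} (hn : 0 < n) :
    (d : ℝ) ≤ (complexityFn T.subshift n : ℝ) / n := by
  rw [T.complexityFn_subshift hd, le_div_iff₀ (by exact_mod_cast hn)]
  exact_mod_cast T.dim_mul_le_card_lang hd n

lemma le_complexityFn_run_div (hd : 1 < d) (m : ℕ) :
    (d : ℝ) + 1 - 2 * (d + 1) / scaleGap d m ≤
      (complexityFn T.subshift (T.run m 0) : ℝ) / T.run m 0 := by
  have h1 := T.dim_succ_mul_le_card_lang hd m
  have h2 := T.gap_tail_le_run hd m (dim_pos (d := d))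
  have h3 := T.tail_pos m
  have h4 : 2 * T.tail m ≤ scaleGap d m * T.tail m := by
    have := le_scaleGap (d := d) m
    exact Nat.mul_le_mul_right _ (by omega)
  have h5 : (0 : ℝ) < scaleGap d m := by exact_mod_cast scaleGap_pos (d := d) m
  have h6 : (0 : ℝ) < T.run m 0 := by exact_mod_cast (show 0 < T.run m 0 by omega)
  rw [T.complexityFn_subshift hd, le_div_iff₀ h6]
  have h7 : T.run m 0 ≤ (T.run m 0 - T.tail m - 1) + 2 * T.tail m := by omega
  have h8 : ((d : ℝ) + 1) * ((T.run m 0 - T.tail m - 1 : ℕ) : ℝ) ≤ (T.lang (T.run m 0)).ncard := by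
    exact_mod_cast h1
  have h9 : (T.run m 0 : ℝ) ≤ ((T.run m 0 - T.tail m - 1 : ℕ) : ℝ) + 2 * T.tail m := by
    exact_mod_cast h7
  have h10 : (T.tail m : ℝ) ≤ T.run m 0 / scaleGap d m := by
    rw [le_div_iff₀ h5, mul_comm]
    exact_mod_cast h2
  refine le_trans ?_ h8
  have h11 : ((d : ℝ) + 1 - 2 * (d + 1) / scaleGap d m) * T.run m 0 =
      (d + 1) * (T.run m 0 - 2 * (T.run m 0 / scaleGap d m)) := by
    field_simp
  rw [h11]
  refine mul_le_mul_of_nonneg_left ?_ (by positivity)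
  linarith

lemma tendsto_div_scaleGap (c : ℝ) :
    Tendsto (fun m => c / (scaleGap d m : ℝ)) atTop (𝓝 0) := by
  apply Tendsto.div_atTop tendsto_const_nhds
  refine tendsto_atTop_mono (fun m => ?_) tendsto_natCast_atTop_atTop
  have := le_scaleGap (d := d) m
  exact_mod_cast (show m ≤ scaleGap d m by omega)

lemma tendsto_tail : Tendsto T.tail atTop atTop :=
  tendsto_atTop_mono T.le_tail_self tendsto_id

lemma liminf_complexityFn (hd : 1 < d) :
    liminf (fun n : ℕ => (((complexityFn T.subshift n : ℝ) / (n : ℝ) : ℝ) : EReal)) atTop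
      = ((d : ℝ) : EReal) := by
  apply le_antisymm
  · have h1 : Tendsto (fun m => (((d : ℝ) + d / scaleGap d m : ℝ) : EReal)) atTop
        (𝓝 ((d : ℝ) : EReal)) := by
      refine (continuous_coe_real_ereal.tendsto _).comp ?_
      simpa using (tendsto_div_scaleGap (d := d) (d : ℝ)).const_add (d : ℝ)
    rw [← h1.liminf_eq]
    refine le_trans ?_ (liminf_le_liminf (Eventually.of_forall fun m =>
      EReal.coe_le_coe_iff.2 (T.complexityFn_tail_div_le hd m)))
    exact T.tendsto_tail.liminf_le_liminf_comp (u := fun n : ℕ => (((complexityFn T.subshift n : ℝ) / (n : ℝ) : ℝ) : EReal))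
  · refine le_liminf_of_le (by isBoundedDefault) ?_
    filter_upwards [eventually_gt_atTop 0] with n hn
    exact EReal.coe_le_coe_iff.2 (T.le_complexityFn_div hd hn)

lemma limsup_complexityFn (hd : 1 < d) :
    limsup (fun n : ℕ => (((complexityFn T.subshift n : ℝ) / (n : ℝ) : ℝ) : EReal)) atTop
      = (((d : ℝ) + 1 : ℝ) : EReal) := by
  apply le_antisymm
  · have h1 : Tendsto (fun M => (((d : ℝ) + 1 + 2 * d / scaleGap d M : ℝ) : EReal)) atTop
        (𝓝 (((d : ℝ) + 1 : ℝ) : EReal)) := by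
      refine (continuous_coe_real_ereal.tendsto _).comp ?_
      simpa using (tendsto_div_scaleGap (d := d) (2 * d : ℝ)).const_add ((d : ℝ) + 1)
    refine ge_of_tendsto' h1 fun M => limsup_le_of_le (by isBoundedDefault) ?_
    filter_upwards [eventually_ge_atTop (T.tail M)] with n hn
    exact EReal.coe_le_coe_iff.2 (T.complexityFn_div_le hd hn)
  · have h1 : Tendsto (fun m => (((d : ℝ) + 1 - 2 * (d + 1) / scaleGap d m : ℝ) : EReal)) atTop
        (𝓝 (((d : ℝ) + 1 : ℝ) : EReal)) := by
      refine (continuous_coe_real_ereal.tendsto _).comp ?_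
      simpa using (tendsto_div_scaleGap (d := d) (2 * (d + 1) : ℝ)).const_sub ((d : ℝ) + 1)
    have h2 : Tendsto (fun m => T.run m 0) atTop atTop :=
      tendsto_atTop_mono (fun m => (T.le_tail_self m).trans (T.tail_le_run hd m dim_pos))
        tendsto_id
    rw [← h1.limsup_eq]
    refine (limsup_le_limsup (Eventually.of_forall fun m =>
      EReal.coe_le_coe_iff.2 (T.le_complexityFn_run_div hd m))).trans ?_
    exact h2.limsup_comp_le_limsup (u := fun n : ℕ => (((complexityFn T.subshift n : ℝ) / (n : ℝ) : ℝ) : EReal))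

end WordTower

/-! ### Cylinders and continuous functions on a subshift. -/

/-- Neighbourhoods in a subshift over a discrete alphabet contain cylinders. -/
lemma Subshift.exists_cylinder_subset {A : Type*} [TopologicalSpace A] (X : Subshift A ℤ)
    {y : X.carrier} {U : Set X.carrier} (hU : U ∈ 𝓝 y) :
    ∃ R : ℕ, ∀ z : X.carrier, (∀ j : ℤ, |j| ≤ R → z.1 j = y.1 j) → z ∈ U := by
  obtain ⟨V, hV, hVU⟩ := mem_nhds_subtype _ _ _ |>.1 hU
  obtain ⟨W, hWV, hW, hyW⟩ := mem_nhds_iff.1 hV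
  obtain ⟨I, u, hu, hI⟩ := isOpen_pi_iff.1 hW y.1 hyW
  refine ⟨∑ j ∈ I, j.natAbs, fun z hz => hVU (hWV (hI fun j hj => ?_))⟩
  rw [hz j]
  · exact (hu j hj).2
  · rw [Int.abs_eq_natAbs]
    exact_mod_cast Finset.single_le_sum (f := fun j : ℤ => j.natAbs) (fun _ _ => Nat.zero_le _) hj

instance Subshift.compactSpace {A : Type*} [TopologicalSpace A] [CompactSpace A]
    (X : Subshift A ℤ) : CompactSpace X.carrier :=
  isCompact_iff_compactSpace.1 X.isClosed.isCompact

lemma cylinder_mem_nhds {A : Type*} [TopologicalSpace A] [DiscreteTopology A] (X : Subshift A ℤ)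
    (y : X.carrier) (R : ℕ) : {z : X.carrier | ∀ j : ℤ, |j| ≤ R → z.1 j = y.1 j} ∈ 𝓝 y := by
  have h : {z : X.carrier | ∀ j : ℤ, |j| ≤ R → z.1 j = y.1 j} =
      ⋂ j ∈ Finset.Icc (-(R : ℤ)) R, {z : X.carrier | z.1 j = y.1 j} := by
    ext z
    simp [abs_le]
  rw [h, Filter.biInter_finset_mem]
  intro j _
  have : Continuous fun z : X.carrier => z.1 j :=
    (continuous_apply j).comp continuous_subtype_val
  exact this.continuousAt.preimage_mem_nhds ((isOpen_discrete {y.1 j}).mem_nhds rfl)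

/-- Continuous functions on a subshift are uniformly approximated on cylinders. -/
lemma exists_cylinder_dist_lt {A : Type*} [TopologicalSpace A] [DiscreteTopology A]
    [CompactSpace A] (X : Subshift A ℤ) {f : X.carrier → ℝ} (hf : Continuous f) {ε : ℝ}
    (hε : 0 < ε) :
    ∃ R : ℕ, ∀ x y : X.carrier, (∀ j : ℤ, |j| ≤ R → x.1 j = y.1 j) → |f x - f y| < ε := by
  have h : ∀ y : X.carrier, ∃ R : ℕ, ∀ z : X.carrier, (∀ j : ℤ, |j| ≤ R → z.1 j = y.1 j) →
      |f z - f y| < ε / 2 := by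
    intro y
    have := hf.continuousAt (x := y) (Metric.ball_mem_nhds (f y) (half_pos hε))
    exact Subshift.exists_cylinder_subset X this
  choose R hR using h
  obtain ⟨t, ht⟩ := CompactSpace.elim_nhds_subcover _ fun y => cylinder_mem_nhds X y (R y)
  refine ⟨∑ y ∈ t, R y, fun x x' hxx' => ?_⟩
  have hx : x ∈ (⊤ : Set X.carrier) := trivial
  rw [← ht] at hx
  obtain ⟨y, hy, hxy⟩ := Set.mem_iUnion₂.1 hx
  have hRy : R y ≤ ∑ y ∈ t, R y :=
    Finset.single_le_sum (f := R) (fun _ _ => Nat.zero_le _) hy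
  have h1 := hR y x hxy
  have h2 := hR y x' fun j hj => by
    rw [← hxx' j (hj.trans (by exact_mod_cast hRy))]
    exact hxy j hj
  rw [abs_lt] at h1 h2 ⊢
  constructor <;> linarith

lemma exists_abs_le {Y : Type*} [TopologicalSpace Y] [CompactSpace Y] {f : Y → ℝ}
    (hf : Continuous f) : ∃ C, 0 ≤ C ∧ ∀ x, |f x| ≤ C := by
  obtain ⟨C, hC⟩ := isCompact_univ.exists_bound_of_continuousOn hf.continuousOn
  exact ⟨max C 0, le_max_right _ _, fun x => (hC x trivial).trans (le_max_left _ _)⟩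

lemma iterate_shiftMap_apply {A : Type*} [TopologicalSpace A] (X : Subshift A ℤ) (k : ℕ)
    (x : X.carrier) (j : ℤ) : ((shiftMap X)^[k] x).1 j = x.1 (k + j) := by
  induction k generalizing x with
  | zero => simp
  | succ k ih =>
    rw [Function.iterate_succ_apply, ih]
    exact congrArg x.1 (show 1 + ((k : ℤ) + j) = (k + 1 : ℕ) + j by push_cast; ring)

lemma continuous_shiftMap {A : Type*} [TopologicalSpace A] (X : Subshift A ℤ) :
    Continuous (shiftMap X) :=
  (SymbolicDynamics.FullShift.continuous_shift (1 : ℤ)).restrict _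

/-! ### Decomposition of points into two periodic pieces, and minimality. -/

namespace WordTower

variable {d : ℕ} [NeZero d] (T : WordTower d)

/-- Every point is, on an initial segment of length `T.tail J`, the concatenation of at most two
pieces of periodic sequences. -/
lemma exists_two_periodic_pieces (hd : 1 < d) (J : ℕ) {x : ℤ → Fin d}
    (hx : x ∈ T.subshift.carrier) : ∃ i i' s : ℕ, ∃ t t' : ℤ, J ≤ i ∧ i < J + d ∧ J ≤ i' ∧
      i' < J + d ∧ s ≤ T.tail J ∧ (∀ k : ℕ, k < s → x k = periodicSeq (T.w i) (t + k)) ∧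
      ∀ k : ℕ, s ≤ k → k < T.tail J → x k = periodicSeq (T.w i') (t' + k) := by
  obtain ⟨q, t, h⟩ := T.legal_of_inLang hd (J := J) (hx 0 (T.tail J)) (by simp)
  rw [length_window, window_eq_window_iff] at h
  have h1 := Nat.mod_lt q (dim_pos (d := d))
  have h2 := Nat.mod_lt (q + 1) (dim_pos (d := d))
  have hs : (min (-t).toNat (T.tail J)) ≤ T.tail J := min_le_right _ _
  refine ⟨J + q % d, J + (q + 1) % d, min (-t).toNat (T.tail J), t, t, by omega, by omega,
    by omega, by omega, hs, fun k hk => ?_, fun k hk hk' => ?_⟩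
  · have := h k (by omega)
    rw [jointSeq_of_neg (by omega), zero_add] at this
    exact this
  · have := h k (by omega)
    rw [jointSeq_of_nonneg (by omega), zero_add] at this
    exact this

/-- A stretch of two period lengths contains a full period starting at phase zero. -/
lemma exists_window_eq_of_periodic {m a b : ℕ} {x : ℤ → Fin d} {t : ℤ}
    (hab : a + 2 * T.len m ≤ b)
    (h : ∀ k : ℕ, a ≤ k → k < b → x k = periodicSeq (T.w m) (t + k)) :
    ∃ p : ℤ, window x p (T.len m) = T.w m := by
  have hpos := T.len_pos m
  have h0 := Int.emod_nonneg (-(t + a)) (b := (T.len m : ℤ)) (by omega)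
  have h1 := Int.emod_lt_of_pos (-(t + a)) (b := (T.len m : ℤ)) (by omega)
  obtain ⟨c, hc⟩ : ∃ c : ℤ, t + a + (-(t + a)) % (T.len m : ℤ) = T.len m * c := by
    refine ⟨-(-(t + a) / (T.len m : ℤ)), ?_⟩
    have := Int.emod_add_mul_ediv (-(t + a)) (T.len m : ℤ)
    linarith
  set r := (-(t + a)) % (T.len m : ℤ)
  refine ⟨a + r, ?_⟩
  conv_rhs => rw [← window_periodicSeq_length (T.w m), T.length_w,
    ← window_periodicSeq_add_mul _ _ c, T.length_w, ← hc]
  rw [window_eq_window_iff]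
  intro k hk
  have := h (a + r.toNat + k) (by omega) (by omega)
  rw [show ((a + r.toNat + k : ℕ) : ℤ) = a + r + k by push_cast; omega] at this
  rw [this]
  congr 1
  ring

lemma four_mul_len_le_tail (m : ℕ) : 4 * T.len (m + d - 1) ≤ T.tail m := by
  have h1 := T.gap_sq_le_tail m
  have h2 := le_scaleGap (d := d) m
  have h3 : 4 ≤ scaleGap d m ^ 2 := by nlinarith
  exact (Nat.mul_le_mul_right _ h3).trans h1

/-- The tail is at least four times the longest base word, so one of the two periodic pieces
contains a complete base word of high level, which contains all earlier words of the tower. -/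
lemma exists_window_eq_of_inLang (hd : 1 < d) {x : ℤ → Fin d} (hx : x ∈ T.subshift.carrier)
    {v : List (Fin d)} (hv : T.InLang v) : ∃ p : ℤ, window x p v.length = v := by
  obtain ⟨m, hm⟩ := hv
  obtain ⟨i, i', s, t, t', hi, hid, hi', hid', hs, h1, h2⟩ :=
    T.exists_two_periodic_pieces hd (m + d) hx
  have h4 := T.four_mul_len_le_tail (m + d)
  obtain ⟨l, hl, p, hp⟩ : ∃ l, m + d ≤ l ∧ ∃ p : ℤ, window x p (T.len l) = T.w l := by
    rcases le_or_gt (2 * T.len (m + d + d - 1)) s with h | h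
    · refine ⟨i, hi, T.exists_window_eq_of_periodic (a := 0) (b := s) ?_ fun k _ => h1 k⟩
      have := T.len_mono hd (show i ≤ m + d + d - 1 by omega)
      omega
    · refine ⟨i', hi', T.exists_window_eq_of_periodic (a := s) (b := T.tail (m + d)) ?_ h2⟩
      have := T.len_mono hd (show i' ≤ m + d + d - 1 by omega)
      omega
  have h3 := hm.trans (T.isInfix_of_le hd (show m ≤ l by omega) (by omega))
  rw [← hp] at h3
  obtain ⟨r, -, hr⟩ := eq_window_of_isInfix h3
  exact ⟨_, hr.symm⟩

lemma isMinimalSubshift (hd : 1 < d) : IsMinimalSubshift T.subshift := by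
  intro x hx
  apply subset_antisymm
  · refine closure_minimal ?_ T.subshift.isClosed
    rintro _ ⟨n, rfl⟩
    exact T.subshift.mapsTo n hx
  · intro y hy
    have key : (⟨y, hy⟩ : T.subshift.carrier) ∈ closure (Set.range fun n : ℤ =>
        (⟨shift n x, T.subshift.mapsTo n hx⟩ : T.subshift.carrier)) := by
      rw [mem_closure_iff_nhds]
      intro U hU
      obtain ⟨R, hR⟩ := Subshift.exists_cylinder_subset _ hU
      obtain ⟨p, hp⟩ := T.exists_window_eq_of_inLang hd hx (hy (-R) (2 * R + 1))
      rw [length_window, window_eq_window_iff] at hp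
      refine ⟨_, hR ⟨shift (p + R) x, T.subshift.mapsTo _ hx⟩ fun j hj => ?_, p + R, rfl⟩
      rw [abs_le] at hj
      have := hp (j + R).toNat (by omega)
      rw [show -(R : ℤ) + ((j + R).toNat : ℤ) = j by omega] at this
      exact Eq.trans (congrArg x (by omega)) this
    have := map_mem_closure continuous_subtype_val key
      (t := Set.range fun n : ℤ => shift n x) (by rintro _ ⟨n, rfl⟩; exact ⟨n, rfl⟩)
    exact this

end WordTower

/-! ### Birkhoff sums along occurrences of the words. -/

lemma abs_birkhoffSum_sub_le {Y : Type*} {σ : Y → Y} {f : Y → ℝ} {C c : ℝ}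
    (hf : ∀ x, |f x| ≤ C) (hc : |c| ≤ C) (n : ℕ) (x : Y) :
    |birkhoffSum σ f n x - n * c| ≤ 2 * C * n := by
  induction n with
  | zero => simp
  | succ n ih =>
    rw [birkhoffSum_succ]
    have h := hf (σ^[n] x)
    rw [abs_le] at *
    push_cast
    constructor <;> linarith

namespace WordTower

variable {d : ℕ} [NeZero d] (T : WordTower d)

/-- The phase space of the tower. -/
abbrev Space : Type := T.subshift.carrier

/-- The Birkhoff averages of `f` along each occurrence of `T.w m` are `δ`-close to `c`. -/
def BlockBound (f : T.Space → ℝ) (c δ : ℝ) (m : ℕ) : Prop :=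
  ∀ x : T.Space, (∀ k : ℕ, k < T.len m → x.1 k = periodicSeq (T.w m) k) →
    |birkhoffSum (shiftMap T.subshift) f (T.len m) x - T.len m * c| ≤ δ * T.len m

variable {T} {f : T.Space → ℝ} {c δ C : ℝ} {m : ℕ}

lemma BlockBound.of_power (h : T.BlockBound f c δ m) (r : ℕ) (x : T.Space)
    (hx : ∀ k : ℕ, k < r * T.len m → x.1 k = periodicSeq (T.w m) k) :
    |birkhoffSum (shiftMap T.subshift) f (r * T.len m) x - (r * T.len m : ℕ) * c| ≤
      δ * (r * T.len m : ℕ) := by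
  induction r generalizing x with
  | zero => simp
  | succ r ih =>
    have h1 := h x fun k hk => hx k (by rw [add_mul]; omega)
    have h2 := ih ((shiftMap T.subshift)^[T.len m] x) fun k hk => by
      have := hx (T.len m + k) (by rw [add_mul]; omega)
      rw [iterate_shiftMap_apply]
      rw [Nat.cast_add] at this
      rw [this, ← periodicSeq_add_mul _ (k : ℤ) 1, T.length_w]
      congr 1
      ring
    rw [show (r + 1) * T.len m = T.len m + r * T.len m by ring, birkhoffSum_add]
    rw [abs_le] at *
    push_cast at *
    constructor <;> linarith

lemma BlockBound.of_initial_periodic (h : T.BlockBound f c δ m) (hδ : 0 ≤ δ)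
    (hf : ∀ x, |f x| ≤ C) (hc : |c| ≤ C) (s : ℕ) (x : T.Space)
    (hx : ∀ k : ℕ, k < s → x.1 k = periodicSeq (T.w m) k) :
    |birkhoffSum (shiftMap T.subshift) f s x - s * c| ≤ δ * s + 2 * C * T.len m := by
  have hC : 0 ≤ C := (abs_nonneg c).trans hc
  have hs := Nat.div_add_mod s (T.len m)
  have hlt := (Nat.mod_lt s (T.len_pos m)).le
  rw [mul_comm] at hs
  have h1 := h.of_power (s / T.len m) x fun k hk => hx k (by omega)
  have h2 := abs_birkhoffSum_sub_le (σ := shiftMap T.subshift) hf hc (s % T.len m)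
    ((shiftMap T.subshift)^[s / T.len m * T.len m] x)
  set q := s / T.len m * T.len m
  set r := s % T.len m
  have h3 : 2 * C * (r : ℝ) ≤ 2 * C * T.len m := by gcongr
  have h4 : 0 ≤ δ * (r : ℝ) := by positivity
  rw [← hs, birkhoffSum_add]
  rw [abs_le] at *
  push_cast
  constructor <;> linarith

/-- Averages over long pieces of periodic sequences. -/
lemma BlockBound.of_periodic (h : T.BlockBound f c δ m) (hδ : 0 ≤ δ)
    (hf : ∀ x, |f x| ≤ C) (hc : |c| ≤ C) (s : ℕ) (x : T.Space) (t : ℤ)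
    (hx : ∀ k : ℕ, k < s → x.1 k = periodicSeq (T.w m) (t + k)) :
    |birkhoffSum (shiftMap T.subshift) f s x - s * c| ≤ δ * s + 4 * C * T.len m := by
  have hC : 0 ≤ C := (abs_nonneg c).trans hc
  have hpos := T.len_pos m
  have h0 := Int.emod_nonneg (-t) (b := (T.len m : ℤ)) (by omega)
  have h1 := Int.emod_lt_of_pos (-t) (b := (T.len m : ℤ)) (by omega)
  obtain ⟨a, ha⟩ := Int.eq_ofNat_of_zero_le h0
  have hta : t + a = T.len m * -(-t / (T.len m : ℤ)) := by
    have := Int.emod_add_mul_ediv (-t) (T.len m : ℤ)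
    rw [ha] at this
    linarith
  have haL : (a : ℝ) ≤ T.len m := by
    have : a ≤ T.len m := by omega
    exact_mod_cast this
  rcases le_total s a with hsa | hsa
  · have h2 := abs_birkhoffSum_sub_le (σ := shiftMap T.subshift) hf hc s x
    have h3 : (s : ℝ) ≤ T.len m := le_trans (by exact_mod_cast hsa) haL
    have h4 : 2 * C * (s : ℝ) ≤ 2 * C * T.len m := by gcongr
    have h5 : 0 ≤ δ * (s : ℝ) := by positivity
    have h6 : 0 ≤ 2 * C * (T.len m : ℝ) := by positivity
    linarith
  · obtain ⟨r, rfl⟩ := Nat.exists_eq_add_of_le hsa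
    have h2 := abs_birkhoffSum_sub_le (σ := shiftMap T.subshift) hf hc a x
    have h3 := h.of_initial_periodic hδ hf hc r ((shiftMap T.subshift)^[a] x) fun k hk => by
      have := hx (a + k) (by omega)
      rw [iterate_shiftMap_apply]
      rw [Nat.cast_add] at this
      rw [this, ← add_assoc, hta, add_comm, ← T.length_w, periodicSeq_add_mul]
    have h4 : 2 * C * (a : ℝ) ≤ 2 * C * T.len m := by gcongr
    have h5 : 0 ≤ δ * (a : ℝ) := by positivity
    rw [birkhoffSum_add]
    rw [abs_le] at *
    push_cast
    constructor <;> linarith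

/-- Outside the first run there is at most a fraction `2⁻⁽ᵐ⁺⁴⁾` of the word, and each letter there
costs at most `2 * C`; this gives the added error `C / 8 / 2 ^ m`. -/
lemma BlockBound.add_dim (h : T.BlockBound f c δ m) (hd : 1 < d) (hδ : 0 ≤ δ)
    (hf : ∀ x, |f x| ≤ C) (hc : |c| ≤ C) :
    T.BlockBound f c (δ + C / 8 / 2 ^ m) (m + d) := by
  intro x hx
  have hC : 0 ≤ C := (abs_nonneg c).trans hc
  have h0 := T.run_le_len m (dim_pos (d := d))
  have h1 := h.of_power (T.e m 0) x fun k hk => by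
    have hk' : k < T.run m 0 := hk
    rw [hx k (by omega), T.periodicSeq_merged m (by omega) (by omega)]
  rw [show T.e m 0 * T.len m = T.run m 0 from rfl] at h1
  obtain ⟨r, hr⟩ := Nat.exists_eq_add_of_le h0
  have h2 := abs_birkhoffSum_sub_le (σ := shiftMap T.subshift) hf hc r
    ((shiftMap T.subshift)^[T.run m 0] x)
  have h3 := T.len_add_le m hd
  have h4 : (2 : ℝ) ^ (m + 4) * r ≤ T.len (m + d) := by
    have : 2 ^ (m + 4) * r ≤ T.len (m + d) := by
      refine le_trans ?_ (h3.trans h0)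
      rw [hr]; simp
    exact_mod_cast this
  have h5 : 2 * C * (r : ℝ) ≤ C / 8 / 2 ^ m * T.len (m + d) := by
    rw [div_div, div_mul_eq_mul_div, le_div_iff₀ (by positivity)]
    calc 2 * C * (r : ℝ) * (8 * 2 ^ m) = C * (2 ^ (m + 4) * r) := by rw [pow_add]; ring
      _ ≤ _ := by gcongr
  have h6 : 0 ≤ δ * (r : ℝ) := by positivity
  have h7 : (T.len (m + d) : ℝ) = T.run m 0 + r := by rw [hr]; push_cast; ring
  have h8 : birkhoffSum (shiftMap T.subshift) f (T.len (m + d)) x =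
      birkhoffSum (shiftMap T.subshift) f (T.run m 0) x +
        birkhoffSum (shiftMap T.subshift) f r ((shiftMap T.subshift)^[T.run m 0] x) := by
    rw [hr, birkhoffSum_add]
  rw [h8, add_mul]
  rw [h7] at h5 ⊢
  rw [abs_le] at *
  constructor <;> linarith

/-- Averages over occurrences of `T.w m` control averages over occurrences of all later words of
the same type. -/
lemma BlockBound.add_mul_dim (h : T.BlockBound f c δ m) (hd : 1 < d) (hδ : 0 ≤ δ)
    (hf : ∀ x, |f x| ≤ C) (hc : |c| ≤ C) (q : ℕ) :
    T.BlockBound f c (δ + C / 4 / 2 ^ m) (m + q * d) := by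
  have hC : 0 ≤ C := (abs_nonneg c).trans hc
  -- The telescoping form closes the induction: the error added at level `M` is half of `C / 4 * (1
  -- / 2 ^ M)`, which is freed when `M` increases to `M + d`.
  have key : T.BlockBound f c (δ + C / 4 * (1 / 2 ^ m - 1 / 2 ^ (m + q * d))) (m + q * d) := by
    induction q with
    | zero => simpa using h
    | succ q ih =>
      have h0 : (1 : ℝ) / 2 ^ (m + q * d) ≤ 1 / 2 ^ m := by
        apply one_div_le_one_div_of_le (by positivity)
        exact pow_le_pow_right₀ (by norm_num) (by omega)
      have h1 := ih.add_dim hd (add_nonneg hδ (mul_nonneg (by positivity) (by linarith))) hf hc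
      rw [show m + (q + 1) * d = m + q * d + d by ring]
      intro x hx
      refine (h1 x hx).trans (mul_le_mul_of_nonneg_right ?_ (by positivity))
      have h2 : (1 : ℝ) / 2 ^ (m + q * d + d) ≤ 1 / 2 ^ (m + q * d) / 2 := by
        rw [div_div, ← pow_succ]
        apply one_div_le_one_div_of_le (by positivity)
        exact pow_le_pow_right₀ (by norm_num) (by omega)
      have h3 : C / 8 / 2 ^ (m + q * d) = C / 4 * (1 / 2 ^ (m + q * d) / 2) := by ring
      rw [h3, add_assoc, ← mul_add]
      gcongr
      linarith
  intro x hx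
  refine (key x hx).trans (mul_le_mul_of_nonneg_right ?_ (by positivity))
  have h4 : C / 4 / 2 ^ m = C / 4 * (1 / 2 ^ m) := by ring
  rw [h4]
  gcongr
  have : (0 : ℝ) ≤ 1 / 2 ^ (m + q * d) := by positivity
  linarith

variable (T)

lemma tendsto_len (hd : 1 < d) : Tendsto T.len atTop atTop := by
  refine tendsto_atTop_atTop.2 fun b => ⟨b + d, fun m hm => ?_⟩
  have h1 := T.le_tail_self b
  have h2 := T.tail_le_run hd b (dim_pos (d := d))
  have h3 := T.run_le_len b (dim_pos (d := d))
  have h4 := T.len_mono hd hm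
  omega

lemma exists_ref (hd : 1 < d) : ∃ y : ℕ → T.Space, ∀ m k : ℕ, k < T.len m →
    (y m).1 k = periodicSeq (T.w m) k := by
  have h : ∀ m, ∃ y : T.Space, ∀ k : ℕ, k < T.len m → y.1 k = periodicSeq (T.w m) k := by
    intro m
    obtain ⟨x, hx, hw⟩ := T.exists_mem_window_eq_w hd m
    refine ⟨⟨x, hx⟩, fun k hk => ?_⟩
    have h1 : window x 0 (T.len m) = window (periodicSeq (T.w m)) 0 (T.len m) := by
      rw [hw]; exact (window_periodicSeq_length _).symm
    simpa using window_eq_window_iff.1 h1 k hk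
  choose y hy using h
  exact ⟨y, hy⟩

/-- A point of the subshift in which `T.w m` occurs at the origin. -/
noncomputable def ref (hd : 1 < d) (m : ℕ) : T.Space := (T.exists_ref hd).choose m

lemma ref_spec (hd : 1 < d) (m : ℕ) {k : ℕ} (hk : k < T.len m) :
    (T.ref hd m).1 k = periodicSeq (T.w m) k := (T.exists_ref hd).choose_spec m k hk

/-- The average of `f` over the occurrence of `T.w m` at the origin of `T.ref m`. -/
noncomputable def refAverage (hd : 1 < d) (f : T.Space → ℝ) (m : ℕ) : ℝ :=
  birkhoffAverage ℝ (shiftMap T.subshift) f (T.len m) (T.ref hd m)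

variable {T}

lemma len_mul_refAverage (hd : 1 < d) (f : T.Space → ℝ) (m : ℕ) :
    T.len m * T.refAverage hd f m =
      birkhoffSum (shiftMap T.subshift) f (T.len m) (T.ref hd m) := by
  have : (T.len m : ℝ) ≠ 0 := by exact_mod_cast (T.len_pos m).ne'
  rw [refAverage, birkhoffAverage, smul_eq_mul, mul_inv_cancel_left₀ this]

lemma BlockBound.abs_refAverage_sub_le (h : T.BlockBound f c δ m) (hd : 1 < d) :
    |T.refAverage hd f m - c| ≤ δ := by
  have h1 := h (T.ref hd m) fun k hk => T.ref_spec hd m hk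
  have h2 : (0 : ℝ) < T.len m := by exact_mod_cast T.len_pos m
  rw [← len_mul_refAverage, ← mul_sub, abs_mul, abs_of_pos h2, mul_comm] at h1
  exact le_of_mul_le_mul_right h1 h2

lemma abs_refAverage_le (hd : 1 < d) (hf : ∀ x, |f x| ≤ C) (m : ℕ) :
    |T.refAverage hd f m| ≤ C := by
  have h2 : (0 : ℝ) < T.len m := by exact_mod_cast T.len_pos m
  have h1 : |birkhoffSum (shiftMap T.subshift) f (T.len m) (T.ref hd m)| ≤ T.len m * C := by
    refine (Finset.abs_sum_le_sum_abs _ _).trans ?_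
    refine (Finset.sum_le_card_nsmul _ _ C fun k _ => hf _).trans ?_
    simp
  rw [← len_mul_refAverage, abs_mul, abs_of_pos h2] at h1
  exact le_of_mul_le_mul_left h1 h2

/-- Averages of a continuous function over two occurrences of a long word are close. -/
lemma exists_blockBound (hd : 1 < d) (hf : Continuous f) (hδ : 0 < δ) :
    ∃ I, ∀ m, I ≤ m → T.BlockBound f (T.refAverage hd f m) δ m := by
  obtain ⟨C, hC, hfC⟩ := exists_abs_le hf
  obtain ⟨R, hR⟩ := exists_cylinder_dist_lt T.subshift hf (half_pos hδ)
  have hlarge := tendsto_natCast_atTop_atTop.comp (T.tendsto_len hd) |>.eventually_ge_atTop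
    (8 * R * C / δ)
  obtain ⟨I, hI⟩ := eventually_atTop.1 hlarge
  refine ⟨I, fun m hm x hx => ?_⟩
  have h1 : 8 * R * C ≤ T.len m * δ := (div_le_iff₀ hδ).1 (hI m hm)
  rw [len_mul_refAverage, birkhoffSum, birkhoffSum, ← Finset.sum_sub_distrib]
  -- Only within distance `R` of an end of the word can the two points disagree on the cylinder that
  -- controls `f`.
  set B := (Finset.range (T.len m)).filter fun k => k < R ∨ T.len m ≤ k + R with hB
  have hcard : B.card ≤ 2 * R := by
    have : B ⊆ Finset.range R ∪ Finset.Ico (T.len m - R) (T.len m) := by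
      intro k hk
      rw [hB, Finset.mem_filter, Finset.mem_range] at hk
      rw [Finset.mem_union, Finset.mem_range, Finset.mem_Ico]
      omega
    refine (Finset.card_le_card this).trans ((Finset.card_union_le _ _).trans ?_)
    rw [Finset.card_range, Nat.card_Ico]
    omega
  have hterm : ∀ k ∈ Finset.range (T.len m), |f ((shiftMap T.subshift)^[k] x) -
      f ((shiftMap T.subshift)^[k] (T.ref hd m))| ≤ δ / 2 + if k ∈ B then 2 * C else 0 := by
    intro k hk
    have hk' := Finset.mem_range.1 hk
    split_ifs with hkB
    · have h2 := hfC ((shiftMap T.subshift)^[k] x)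
      have h3 := hfC ((shiftMap T.subshift)^[k] (T.ref hd m))
      rw [abs_le] at *
      constructor <;> linarith
    · rw [add_zero]
      refine (hR _ _ fun j hj => ?_).le
      rw [hB, Finset.mem_filter, not_and_or] at hkB
      have hkB := hkB.resolve_left (by simpa using hk')
      rw [abs_le] at hj
      rw [iterate_shiftMap_apply, iterate_shiftMap_apply,
        show (k : ℤ) + j = ((k + j).toNat : ℤ) by omega, hx _ (by omega),
        T.ref_spec hd m (by omega)]
  refine (Finset.abs_sum_le_sum_abs _ _).trans ((Finset.sum_le_sum hterm).trans ?_)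
  rw [Finset.sum_add_distrib, Finset.sum_const, Finset.card_range, nsmul_eq_mul,
    Finset.sum_ite_mem, Finset.sum_const, nsmul_eq_mul]
  have h4 : ((Finset.range (T.len m) ∩ B).card : ℝ) ≤ 2 * R := by
    exact_mod_cast (Finset.card_le_card Finset.inter_subset_right).trans hcard
  have h5 : ((Finset.range (T.len m) ∩ B).card : ℝ) * (2 * C) ≤ 2 * R * (2 * C) := by gcongr
  linarith

end WordTower

/-! ### Abstract criteria for ergodic and generic measures. -/

section FinitelyManyMeasures

lemma continuous_birkhoffAverage {X : Type*} [TopologicalSpace X] {σ : X → X} (hσ : Continuous σ) {f : X → ℝ}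
    (hf : Continuous f) (n : ℕ) : Continuous (birkhoffAverage ℝ σ f n) := by
  have : birkhoffAverage ℝ σ f n =
      fun x => (n : ℝ)⁻¹ * ∑ k ∈ Finset.range n, f (σ^[k] x) := rfl
  rw [this]
  exact continuous_const.mul (continuous_finsetSum _ fun k _ => hf.comp (hσ.iterate k))

lemma measure_ext_of_continuous {X : Type*} [TopologicalSpace X] [MeasurableSpace X] [BorelSpace X]
    [HasOuterApproxClosed X] {μ ν : Measure X} [IsFiniteMeasure μ] [IsFiniteMeasure ν]
    (h : ∀ f : X → ℝ, Continuous f → ∫ x, f x ∂μ = ∫ x, f x ∂ν) : μ = ν :=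
  ext_of_forall_integral_eq_of_IsFiniteMeasure fun f => h f f.continuous

variable {X : Type*} [TopologicalSpace X] [CompactSpace X] [MeasurableSpace X] [BorelSpace X]

lemma integrable_of_continuous {f : X → ℝ} (hf : Continuous f) (μ : Measure X)
    [IsFiniteMeasure μ] : Integrable f μ := by
  obtain ⟨C, -, hC⟩ := exists_abs_le hf
  exact Integrable.of_bound hf.measurable.aestronglyMeasurable C (Eventually.of_forall hC)

lemma integral_birkhoffAverage {σ : X → X} {μ : Measure X} [IsFiniteMeasure μ]
    (hσ : Continuous σ) (hμ : MeasurePreserving σ μ μ) {f : X → ℝ} (hf : Continuous f) {n : ℕ}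
    (hn : 0 < n) : ∫ x, birkhoffAverage ℝ σ f n x ∂μ = ∫ x, f x ∂μ := by
  have h1 : ∀ k, ∫ x, f (σ^[k] x) ∂μ = ∫ x, f x ∂μ := fun k => by
    have hk := hμ.iterate k
    rw [← integral_map hk.measurable.aemeasurable (by
      rw [hk.map_eq]; exact hf.measurable.aestronglyMeasurable), hk.map_eq]
  have h2 : ∀ x, birkhoffAverage ℝ σ f n x =
      (n : ℝ)⁻¹ * ∑ k ∈ Finset.range n, f (σ^[k] x) := fun _ => rfl
  simp_rw [h2]
  have h3 : ∀ k ∈ Finset.range n, Integrable (fun x => f (σ^[k] x)) μ := fun k _ =>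
    integrable_of_continuous (hf.comp (hσ.iterate k)) μ
  rw [integral_const_mul, integral_finsetSum _ h3]
  simp_rw [h1]
  have : (n : ℝ) ≠ 0 := by exact_mod_cast hn.ne'
  simp [this]

variable {ι : Type*} [Fintype ι] {σ : X → X} {μ : ι → Measure X}

/-- If Birkhoff averages of continuous functions are, along a sequence of times, uniformly close to
convex combinations of the integrals against finitely many measures, then each invariant
probability measure is a convex combination of these measures. -/
lemma exists_convex_combination (hσ : Continuous σ)
    (L : ℕ → ℕ) (hL : ∀ J, 0 < L J) (c : ℕ → X → ι → ℝ) (hcm : ∀ J j, Measurable fun x => c J x j)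
    (hc : ∀ J x, c J x ∈ stdSimplex ℝ ι)
    (H : ∀ f : X → ℝ, Continuous f → ∀ ε : ℝ, 0 < ε → ∀ᶠ J in atTop, ∀ x,
      |birkhoffAverage ℝ σ f (L J) x - ∑ j, c J x j * ∫ y, f y ∂(μ j)| ≤ ε)
    (ν : Measure X) [IsProbabilityMeasure ν] (hν : MeasurePreserving σ ν ν) :
    ∃ a ∈ stdSimplex ℝ ι, ∀ f : X → ℝ, Continuous f →
      ∫ x, f x ∂ν = ∑ j, a j * ∫ x, f x ∂(μ j) := by
  have hle : ∀ J x j, c J x j ≤ 1 := fun J x j => by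
    rw [← (hc J x).2]
    exact Finset.single_le_sum (f := c J x) (fun i _ => (hc J x).1 i) (Finset.mem_univ j)
  have hint : ∀ J j, Integrable (fun x => c J x j) ν := fun J j =>
    Integrable.of_bound (hcm J j).aestronglyMeasurable 1 (Eventually.of_forall fun x => by
      rw [Real.norm_eq_abs, abs_of_nonneg ((hc J x).1 j)]; exact hle J x j)
  set b : ℕ → ι → ℝ := fun J j => ∫ x, c J x j ∂ν with hb
  have hbmem : ∀ J, b J ∈ stdSimplex ℝ ι := by
    refine fun J => ⟨fun j => integral_nonneg fun x => (hc J x).1 j, ?_⟩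
    rw [hb, ← integral_finsetSum _ fun j _ => hint J j]
    simp_rw [(hc J _).2]
    simp
  -- The weights averaged over `ν` lie in a compact simplex and do not involve `f`, so one
  -- subsequence serves all test functions.
  obtain ⟨a, ha, φ, hφ, hlim⟩ := (isCompact_stdSimplex ℝ ι).tendsto_subseq hbmem
  refine ⟨a, ha, fun f hf => ?_⟩
  have h1 : Tendsto (fun J => ∑ j, b J j * ∫ x, f x ∂(μ j)) atTop (𝓝 (∫ x, f x ∂ν)) := by
    refine Metric.tendsto_atTop.2 fun ε hε => ?_
    obtain ⟨I, hI⟩ := eventually_atTop.1 (H f hf (ε / 2) (half_pos hε))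
    refine ⟨I, fun J hJ => ?_⟩
    have hsum : ∑ j, b J j * ∫ x, f x ∂(μ j) = ∫ x, ∑ j, c J x j * ∫ y, f y ∂(μ j) ∂ν := by
      rw [integral_finsetSum _ fun j _ => (hint J j).mul_const _]
      simp_rw [integral_mul_const]
      rfl
    rw [dist_comm, Real.dist_eq, hsum, ← integral_birkhoffAverage hσ hν hf (hL J),
      ← integral_sub (integrable_of_continuous (continuous_birkhoffAverage hσ hf _) ν)
        (integrable_finsetSum _ fun j _ => (hint J j).mul_const _)]
    have hbound : ∀ x, ‖birkhoffAverage ℝ σ f (L J) x - ∑ j, c J x j * ∫ y, f y ∂(μ j)‖ ≤ ε / 2 :=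
      hI J hJ
    refine (norm_integral_le_of_norm_le_const (μ := ν) (Eventually.of_forall hbound)).trans_lt ?_
    simp
    linarith
  have h2 : Tendsto (fun J => ∑ j, b (φ J) j * ∫ x, f x ∂(μ j)) atTop
      (𝓝 (∑ j, a j * ∫ x, f x ∂(μ j))) :=
    tendsto_finsetSum _ fun j _ => ((tendsto_pi_nhds.1 hlim) j).mul_const _
  exact tendsto_nhds_unique (h1.comp hφ.tendsto_atTop) h2

lemma integral_sum_smul_of_continuous [∀ i, IsProbabilityMeasure (μ i)] (a : ι → ℝ)
    (ha : ∀ i, 0 ≤ a i) {f : X → ℝ} (hf : Continuous f) :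
    ∫ x, f x ∂(∑ j, ENNReal.ofReal (a j) • μ j) = ∑ j, a j * ∫ x, f x ∂(μ j) := by
  rw [integral_finsetSum_measure fun j _ =>
    (integrable_of_continuous hf (μ j)).smul_measure ENNReal.ofReal_ne_top]
  refine Finset.sum_congr rfl fun j _ => ?_
  rw [integral_smul_measure, ENNReal.toReal_ofReal (ha j), smul_eq_mul]

variable [HasOuterApproxClosed X]

/-- If invariant probability measures are convex combinations of finitely many invariant measures
which are separated by continuous functions, then the ergodic measures are exactly these. -/
lemma ergodic_iff_exists_eq [∀ i, IsProbabilityMeasure (μ i)]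
    (hμ : ∀ i, MeasurePreserving σ (μ i) (μ i))
    (hconv : ∀ ν : Measure X, IsProbabilityMeasure ν → MeasurePreserving σ ν ν →
      ∃ a ∈ stdSimplex ℝ ι, ∀ f : X → ℝ, Continuous f →
        ∫ x, f x ∂ν = ∑ j, a j * ∫ x, f x ∂(μ j))
    (g : ι → X → ℝ) (hg : ∀ i, Continuous (g i)) (h1 : ∀ i, 3 / 4 ≤ ∫ x, g i x ∂(μ i))
    (h2 : ∀ i j, j ≠ i → ∫ x, g i x ∂(μ j) ≤ 1 / 4) (ν : Measure X) :
    (IsProbabilityMeasure ν ∧ Ergodic σ ν) ↔ ∃ i, ν = μ i := by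
  classical
  -- Mass placed away from `i` contributes at most 1/4 per unit, so missing the vertex `i` strictly
  -- lowers the integral of `g i`. Below, this forces `a i = 1` for a component of `μ i`.
  have aux : ∀ (i : ι) (a : ι → ℝ), a ∈ stdSimplex ℝ ι →
      ∑ j, a j * ∫ x, g i x ∂(μ j) ≤
        ∫ x, g i x ∂(μ i) - (1 - a i) * (∫ x, g i x ∂(μ i) - 1 / 4) := by
    intro i a ha
    have h3 : 1 - a i = ∑ j ∈ Finset.univ.erase i, a j := by
      rw [← ha.2, ← Finset.add_sum_erase _ _ (Finset.mem_univ i)]; ring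
    have h4 : ∑ j ∈ Finset.univ.erase i, a j * ∫ x, g i x ∂(μ j) ≤ (1 - a i) * (1 / 4) := by
      rw [h3, Finset.sum_mul]
      exact Finset.sum_le_sum fun j hj =>
        mul_le_mul_of_nonneg_left (h2 i j (Finset.ne_of_mem_erase hj)) (ha.1 j)
    rw [← Finset.add_sum_erase _ _ (Finset.mem_univ i)]
    linarith
  have hle : ∀ (i : ι) (a : ι → ℝ), a ∈ stdSimplex ℝ ι → a i ≤ 1 := fun i a ha => by
    rw [← ha.2]
    exact Finset.single_le_sum (f := a) (fun i _ => ha.1 i) (Finset.mem_univ i)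
  constructor
  · rintro ⟨hprob, herg⟩
    obtain ⟨a, ha, hf⟩ := hconv ν hprob herg.toMeasurePreserving
    have hfin : IsFiniteMeasure (∑ j, ENNReal.ofReal (a j) • μ j) := by
      refine ⟨?_⟩
      simp only [Measure.coe_finsetSum, Finset.sum_apply, Measure.smul_apply, measure_univ,
        smul_eq_mul, mul_one]
      exact ENNReal.sum_lt_top.2 fun j _ => ENNReal.ofReal_lt_top
    have heq : ν = ∑ j, ENNReal.ofReal (a j) • μ j :=
      measure_ext_of_continuous fun f hfc => by
        rw [hf f hfc, integral_sum_smul_of_continuous a ha.1 hfc]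
    obtain ⟨i, hi⟩ : ∃ i, 0 < a i := by
      by_contra! hneg
      have h3 := Finset.sum_nonpos fun j (_ : j ∈ Finset.univ) => hneg j
      have h4 := ha.2
      linarith
    -- As `a i > 0`, the measure `μ i` is absolutely continuous with respect to `ν`, and ergodicity
    -- of `ν` leaves no other invariant probability measure with this property.
    refine ⟨i, (herg.eq_of_absolutelyContinuous (hμ i) ?_).symm⟩
    refine Measure.AbsolutelyContinuous.mk fun s _ hs0 => ?_
    rw [heq, Measure.coe_finsetSum, Finset.sum_apply, Finset.sum_eq_zero_iff] at hs0
    have h5 := hs0 i (Finset.mem_univ i)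
    rw [Measure.smul_apply, smul_eq_mul, mul_eq_zero] at h5
    exact h5.resolve_left (by simpa using hi)
  · rintro ⟨i, rfl⟩
    refine ⟨inferInstance, Ergodic.of_mem_extremePoints ?_⟩
    rw [mem_extremePoints_iff_left]
    refine ⟨⟨hμ i, inferInstance⟩, ?_⟩
    rintro ν₁ ⟨hν₁, hp₁⟩ ν₂ ⟨hν₂, hp₂⟩ ⟨p, q, hp, hq, hpq, hsum⟩
    obtain ⟨a, ha, hfa⟩ := hconv ν₁ hp₁ hν₁
    obtain ⟨b, hb, hfb⟩ := hconv ν₂ hp₂ hν₂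
    have hptop : p ≠ ⊤ := ne_top_of_le_ne_top ENNReal.one_ne_top (hpq ▸ le_self_add)
    have hqtop : q ≠ ⊤ := ne_top_of_le_ne_top ENNReal.one_ne_top (hpq ▸ le_add_self)
    have hpq' : p.toReal + q.toReal = 1 := by
      rw [← ENNReal.toReal_add hptop hqtop, hpq]; simp
    have hp' : 0 < p.toReal := ENNReal.toReal_pos hp.ne' hptop
    have hq' : 0 < q.toReal := ENNReal.toReal_pos hq.ne' hqtop
    have hG : ∫ x, g i x ∂(μ i) =
        p.toReal * ∫ x, g i x ∂ν₁ + q.toReal * ∫ x, g i x ∂ν₂ := by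
      conv_lhs => rw [← hsum]
      rw [integral_add_measure
        ((integrable_of_continuous (hg i) ν₁).smul_measure hptop)
        ((integrable_of_continuous (hg i) ν₂).smul_measure hqtop),
        integral_smul_measure, integral_smul_measure]
      simp
    have ha1 := aux i a ha
    have hb1 := aux i b hb
    rw [← hfa _ (hg i)] at ha1
    rw [← hfb _ (hg i)] at hb1
    have hG1 := h1 i
    set G := ∫ x, g i x ∂(μ i)
    have hb2 : ∫ x, g i x ∂ν₂ ≤ G := by
      have := mul_nonneg (sub_nonneg.2 (hle i b hb)) (show 0 ≤ G - 1 / 4 by linarith)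
      linarith
    have h3 : p.toReal * ∫ x, g i x ∂ν₁ ≤ p.toReal * (G - (1 - a i) * (G - 1 / 4)) := by gcongr
    have h4 : q.toReal * ∫ x, g i x ∂ν₂ ≤ q.toReal * G := by gcongr
    have h5 : p.toReal * ((1 - a i) * (G - 1 / 4)) ≤ 0 := by
      have : G = (p.toReal + q.toReal) * G := by rw [hpq', one_mul]
      linarith
    have hai : a i = 1 := by
      by_contra hne
      have h6 : 0 < 1 - a i := sub_pos.2 (lt_of_le_of_ne (hle i a ha) hne)
      have : 0 < p.toReal * ((1 - a i) * (G - 1 / 4)) :=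
        mul_pos hp' (mul_pos h6 (by linarith))
      linarith
    have haj : ∀ j, j ≠ i → a j = 0 := by
      intro j hj
      have h6 := ha.2
      rw [← Finset.add_sum_erase _ _ (Finset.mem_univ i), hai] at h6
      have h7 := Finset.single_le_sum (f := a) (fun k _ => ha.1 k)
        (Finset.mem_erase.2 ⟨hj, Finset.mem_univ j⟩)
      have := ha.1 j
      linarith
    refine measure_ext_of_continuous fun f hf => ?_
    rw [hfa f hf, Finset.sum_eq_single i (fun j _ hj => by rw [haj j hj, zero_mul])
      (fun h => absurd (Finset.mem_univ i) h), hai, one_mul]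

/-- If the averages along the orbit of a generic point come close to the integrals against one of
finitely many measures, infinitely often, then the generic measure is among them. -/
lemma eq_of_isGenericPointFor {X ι : Type*} [TopologicalSpace X] [MeasurableSpace X]
    [BorelSpace X] [HasOuterApproxClosed X] [Finite ι] {σ : X → X} {μ : ι → Measure X}
    [∀ i, IsProbabilityMeasure (μ i)] {ν : Measure X}
    [IsProbabilityMeasure ν] {x : X} (hx : IsGenericPointFor σ ν x) (N : ℕ → ℕ) (τ : ℕ → ι)
    (hN : Tendsto N atTop atTop)
    (H : ∀ f : X → ℝ, Continuous f → ∀ ε : ℝ, 0 < ε → ∀ᶠ J in atTop,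
      |birkhoffAverage ℝ σ f (N J) x - ∫ y, f y ∂(μ (τ J))| ≤ ε) : ∃ i, ν = μ i := by
  -- Pigeonhole: some index is selected infinitely often, and the limit along the orbit may be
  -- computed at those times.
  obtain ⟨i, hi⟩ : ∃ i, ∃ᶠ J in atTop, τ J = i := by
    by_contra! hne
    obtain ⟨J, hJ⟩ := (eventually_all.2 hne).exists
    exact hJ (τ J) rfl
  refine ⟨i, measure_ext_of_continuous fun f hf => ?_⟩
  refine eq_of_forall_dist_le fun ε hε => ?_
  have h1 := ((hx f hf).comp hN).eventually (Metric.closedBall_mem_nhds _ (half_pos hε))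
  obtain ⟨J, hJ, h2, h3⟩ := (hi.and_eventually (h1.and (H f hf (ε / 2) (half_pos hε)))).exists
  rw [hJ] at h3
  change dist (birkhoffAverage ℝ σ f (N J) x) _ ≤ _ at h2
  rw [dist_comm] at h2
  rw [← Real.dist_eq] at h3
  exact (dist_triangle _ _ _).trans (by linarith)

end FinitelyManyMeasures

/-! ### The limit measures of the d residue classes. -/

namespace WordTower

variable {d : ℕ} [NeZero d] (T : WordTower d)

/-- The empirical measure of `T.ref m` along the occurrence of `T.w m` at the origin. -/
noncomputable def empirical (hd : 1 < d) (m : ℕ) : Measure T.Space :=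
  (T.len m : ENNReal)⁻¹ •
    ∑ k ∈ Finset.range (T.len m), Measure.dirac ((shiftMap T.subshift)^[k] (T.ref hd m))

instance isProbabilityMeasure_empirical (hd : 1 < d) (m : ℕ) :
    IsProbabilityMeasure (T.empirical hd m) := by
  constructor
  have h : (T.len m : ENNReal) ≠ 0 := by exact_mod_cast (T.len_pos m).ne'
  simp [empirical, ENNReal.inv_mul_cancel h]

lemma integral_empirical (hd : 1 < d) (m : ℕ) {f : T.Space → ℝ} (hf : Continuous f) :
    ∫ x, f x ∂(T.empirical hd m) = T.refAverage hd f m := by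
  rw [empirical, integral_smul_measure,
    integral_finsetSum_measure fun k _ => integrable_of_continuous hf _]
  simp only [integral_dirac]
  rw [refAverage, birkhoffAverage, birkhoffSum]
  simp

/-- Probability measures on a compact space form a compact space, so a limit along an ultrafilter
exists for all test functions at once, without proving convergence of the empirical measures. -/
lemma exists_limit_measure (hd : 1 < d) (i : ℕ) : ∃ μ : Measure T.Space, IsProbabilityMeasure μ ∧
    ∀ f : T.Space → ℝ, Continuous f →
      Tendsto (fun q : ℕ => T.refAverage hd f (i + q * d)) (hyperfilter ℕ : Filter ℕ)
        (𝓝 (∫ x, f x ∂μ)) := by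
  set ν : ℕ → ProbabilityMeasure T.Space := fun q => ⟨T.empirical hd (i + q * d), inferInstance⟩
  have hlim := ((hyperfilter ℕ).map ν).le_nhds_lim
  refine ⟨(((hyperfilter ℕ).map ν).lim : ProbabilityMeasure T.Space), inferInstance,
    fun f hf => ?_⟩
  have h : Tendsto ν (hyperfilter ℕ : Filter ℕ) (𝓝 ((hyperfilter ℕ).map ν).lim) := hlim
  rw [ProbabilityMeasure.tendsto_iff_forall_integral_tendsto] at h
  have h1 := h (BoundedContinuousFunction.mkOfCompact ⟨f, hf⟩)
  refine h1.congr fun q => ?_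
  exact T.integral_empirical hd _ hf

/-- The invariant measure describing the words of type `i`. -/
noncomputable def limitMeasure (hd : 1 < d) (i : Fin d) : Measure T.Space :=
  (T.exists_limit_measure hd i).choose

instance isProbabilityMeasure_limitMeasure (hd : 1 < d) (i : Fin d) :
    IsProbabilityMeasure (T.limitMeasure hd i) := (T.exists_limit_measure hd i).choose_spec.1

lemma tendsto_limitMeasure (hd : 1 < d) (i : Fin d) {f : T.Space → ℝ} (hf : Continuous f) :
    Tendsto (fun q : ℕ => T.refAverage hd f (i + q * d)) (hyperfilter ℕ : Filter ℕ)
      (𝓝 (∫ x, f x ∂(T.limitMeasure hd i))) :=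
  (T.exists_limit_measure hd i).choose_spec.2 f hf

/-- Shifting an orbit segment changes its Birkhoff sum only by two boundary terms, which vanish
after division by the length. -/
lemma measurePreserving_limitMeasure (hd : 1 < d) (i : Fin d) :
    MeasurePreserving (shiftMap T.subshift) (T.limitMeasure hd i) (T.limitMeasure hd i) := by
  have hσ := continuous_shiftMap T.subshift
  refine ⟨hσ.measurable, ?_⟩
  have : IsProbabilityMeasure (Measure.map (shiftMap T.subshift) (T.limitMeasure hd i)) :=
    Measure.isProbabilityMeasure_map hσ.measurable.aemeasurable
  refine measure_ext_of_continuous fun f hf => ?_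
  rw [integral_map hσ.measurable.aemeasurable hf.measurable.aestronglyMeasurable]
  have h1 := T.tendsto_limitMeasure hd i (hf.comp hσ)
  have h2 := T.tendsto_limitMeasure hd i hf
  obtain ⟨C, hC, hfC⟩ := exists_abs_le hf
  have h3 : Tendsto (fun q : ℕ => T.refAverage hd (f ∘ shiftMap T.subshift) (i + q * d) -
      T.refAverage hd f (i + q * d)) atTop (𝓝 0) := by
    have h4 : Tendsto (fun q : ℕ => 2 * C / (T.len (i + q * d) : ℝ)) atTop (𝓝 0) := by
      apply Tendsto.div_atTop tendsto_const_nhds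
      refine tendsto_natCast_atTop_atTop.comp ((T.tendsto_len hd).comp ?_)
      refine tendsto_atTop_mono (fun q => ?_) tendsto_id
      exact (Nat.le_mul_of_pos_right q dim_pos).trans (Nat.le_add_left _ _)
    refine squeeze_zero_norm (fun q => ?_) h4
    have h5 : (0 : ℝ) < T.len (i + q * d) := by exact_mod_cast T.len_pos _
    rw [le_div_iff₀ h5, Real.norm_eq_abs, ← abs_of_pos h5, ← abs_mul, mul_comm, mul_sub,
      len_mul_refAverage, len_mul_refAverage]
    set n := T.len (i + q * d)
    set y := T.ref hd (i + q * d)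
    have h6 : birkhoffSum (shiftMap T.subshift) (f ∘ shiftMap T.subshift) n y =
        birkhoffSum (shiftMap T.subshift) f n (shiftMap T.subshift y) := by
      simp only [birkhoffSum, Function.comp_apply, ← Function.iterate_succ_apply',
        ← Function.iterate_succ_apply]
    rw [h6, birkhoffSum_apply_sub_birkhoffSum]
    have h7 := hfC ((shiftMap T.subshift)^[n] y)
    have h8 := hfC y
    rw [abs_le] at *
    constructor <;> linarith
  have h9 := tendsto_nhds_unique (h3.mono_left Nat.hyperfilter_le_atTop) (h1.sub h2)
  simp only [Function.comp_apply] at h9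
  linarith

variable {T} in
lemma BlockBound.abs_integral_limitMeasure_sub_le {f : T.Space → ℝ} {c δ C : ℝ} {m : ℕ}
    (h : T.BlockBound f c δ m) (hd : 1 < d) (hδ : 0 ≤ δ) (hf : Continuous f)
    (hfC : ∀ x, |f x| ≤ C) (hc : |c| ≤ C) :
    |∫ x, f x ∂(T.limitMeasure hd (Fin.ofNat d m)) - c| ≤ δ + C / 4 / 2 ^ m := by
  have h1 := ((T.tendsto_limitMeasure hd (Fin.ofNat d m) hf).sub_const c).abs
  refine le_of_tendsto h1 (Nat.hyperfilter_le_atTop ?_)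
  -- From `q = m / d` on, the levels in the residue class have the form `m + r * d`, where the bound
  -- at level `m` persists.
  filter_upwards [eventually_ge_atTop (m / d)] with q hq
  obtain ⟨r, rfl⟩ := Nat.exists_eq_add_of_le hq
  have h2 := (h.add_mul_dim hd hδ hfC hc r).abs_refAverage_sub_le hd
  have h3 : ((Fin.ofNat d m : Fin d) : ℕ) + (m / d + r) * d = m + r * d := by
    have := Nat.mod_add_div m d
    rw [Fin.val_ofNat, add_mul, mul_comm (m / d)]
    omega
  rw [h3]
  exact h2

/-- Along occurrences of long words, averages are close to the integral against the corresponding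
limit measure. -/
lemma eventually_blockBound (hd : 1 < d) {f : T.Space → ℝ} (hf : Continuous f) {ε : ℝ}
    (hε : 0 < ε) : ∃ I, ∀ m, I ≤ m →
      T.BlockBound f (∫ x, f x ∂(T.limitMeasure hd (Fin.ofNat d m))) ε m := by
  obtain ⟨C, hC, hfC⟩ := exists_abs_le hf
  obtain ⟨I, hI⟩ := exists_blockBound hd hf (show 0 < ε / 3 by positivity)
  have h0 : Tendsto (fun m : ℕ => C / 4 / (2 : ℝ) ^ m) atTop (𝓝 0) :=
    Tendsto.div_atTop tendsto_const_nhds (tendsto_pow_atTop_atTop_of_one_lt (by norm_num))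
  obtain ⟨I', hI'⟩ := eventually_atTop.1 (h0.eventually_le_const (show 0 < ε / 3 by positivity))
  refine ⟨max I I', fun m hm x hx => ?_⟩
  have hb := hI m (le_of_max_le_left hm)
  have h1 := hb x hx
  have h2 := hb.abs_integral_limitMeasure_sub_le hd (by positivity) hf hfC
    (abs_refAverage_le hd hfC m)
  have h3 := hI' m (le_of_max_le_right hm)
  set c := T.refAverage hd f m
  set b := ∫ x, f x ∂(T.limitMeasure hd (Fin.ofNat d m))
  have h4 : |b - c| ≤ 2 * ε / 3 := by linarith
  have h5 : |(T.len m : ℝ) * (c - b)| ≤ T.len m * (2 * ε / 3) := by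
    rw [abs_mul, abs_of_nonneg (Nat.cast_nonneg _), abs_sub_comm]
    gcongr
  rw [abs_le] at *
  constructor <;> linarith

/-- The indicator function of the points with letter `i` at the origin. -/
noncomputable def letterIndicator (i : Fin d) (x : T.Space) : ℝ := if x.1 0 = i then 1 else 0

lemma continuous_letterIndicator (i : Fin d) : Continuous (T.letterIndicator i) := by
  have h1 : Continuous fun x : T.Space => x.1 0 := (continuous_apply 0).comp continuous_subtype_val
  exact (continuous_of_discreteTopology (f := fun a : Fin d => if a = i then (1 : ℝ) else 0)).comp h1

/-- At the initial level `j` the word is a single letter, so the block bound holds with zero error;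
later levels add at most `1 / 4` in total. -/
lemma abs_integral_letterIndicator_sub_le (hd : 1 < d) (i j : Fin d) :
    |∫ x, T.letterIndicator i x ∂(T.limitMeasure hd j) - if j = i then 1 else 0| ≤ 1 / 4 := by
  have hb : T.BlockBound (T.letterIndicator i) (if j = i then 1 else 0) 0 j := by
    intro x hx
    have h1 := hx 0 (T.len_pos _)
    rw [Nat.cast_zero, (T.periodicSeq_zero_neg_one hd _).1, Fin.ofNat_val_eq_self] at h1
    rw [T.len_init j.2, birkhoffSum_one, letterIndicator, h1]
    simp
  have h2 := hb.abs_integral_limitMeasure_sub_le (C := 1) hd le_rfl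
    (T.continuous_letterIndicator i)
    (fun x => by rw [letterIndicator]; split_ifs <;> simp) (by split_ifs <;> simp)
  rw [Fin.ofNat_val_eq_self] at h2
  refine h2.trans ?_
  rw [zero_add]
  exact div_le_self (by norm_num) (one_le_pow₀ (by norm_num))

end WordTower

/-! ### Classification of invariant and generic measures. -/

namespace WordTower

variable {d : ℕ} [NeZero d] (T : WordTower d)

/-- The initial segment of length `T.tail J` of `x` consists of a piece of the periodic sequence of
`T.w i` of length `s`, followed by a piece of the periodic sequence of `T.w i'`. -/
structure TwoPieces (J i i' s : ℕ) (x : ℤ → Fin d) : Prop where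
  left_ge : J ≤ i
  left_lt : i < J + d
  right_ge : J ≤ i'
  right_lt : i' < J + d
  le_tail : s ≤ T.tail J
  left : ∃ t : ℤ, ∀ k : ℕ, k < s → x k = periodicSeq (T.w i) (t + k)
  right : ∃ t : ℤ, ∀ k : ℕ, s ≤ k → k < T.tail J → x k = periodicSeq (T.w i') (t + k)

/-- The decomposition is chosen as a function of the window alone, which makes the resulting weights
measurable in the point. -/
lemma exists_twoPieces_of_window (hd : 1 < d) (J : ℕ) (v : List (Fin d)) :
    ∃ i i' s : ℕ, ∀ x ∈ T.subshift.carrier, window x 0 (T.tail J) = v → T.TwoPieces J i i' s x := by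
  by_cases h : ∃ x ∈ T.subshift.carrier, window x 0 (T.tail J) = v
  · obtain ⟨x, hx, hxv⟩ := h
    obtain ⟨i, i', s, t, t', h1, h2, h3, h4, h5, h6, h7⟩ := T.exists_two_periodic_pieces hd J hx
    refine ⟨i, i', s, fun y _ hyv => ⟨h1, h2, h3, h4, h5, ⟨t, fun k hk => ?_⟩,
      ⟨t', fun k hk hk' => ?_⟩⟩⟩
    all_goals
      rw [← hyv, window_eq_window_iff] at hxv
      have h8 := hxv k (by omega)
      simp only [zero_add] at h8
      rw [← h8]
    · exact h6 k hk
    · exact h7 k hk hk'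
  · exact ⟨0, 0, 0, fun x hx hxv => absurd ⟨x, hx, hxv⟩ h⟩

variable {T}

lemma TwoPieces.abs_birkhoffSum_left_le {J i i' s : ℕ} {x : T.Space}
    (h : T.TwoPieces J i i' s x.1) (hd : 1 < d) {f : T.Space → ℝ} {C c δ : ℝ}
    (hb : T.BlockBound f c δ i) (hδ : 0 ≤ δ) (hf : ∀ x, |f x| ≤ C) (hc : |c| ≤ C) :
    |birkhoffSum (shiftMap T.subshift) f s x - s * c| ≤ δ * s + 4 * C * T.len (J + d - 1) := by
  obtain ⟨t, ht⟩ := h.left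
  have hC : 0 ≤ C := (abs_nonneg c).trans hc
  refine (hb.of_periodic hδ hf hc s x t ht).trans ?_
  have : (T.len i : ℝ) ≤ T.len (J + d - 1) := by
    exact_mod_cast T.len_mono hd (by have := h.left_lt; omega)
  gcongr

lemma TwoPieces.abs_birkhoffSum_right_le {J i i' s : ℕ} {x : T.Space}
    (h : T.TwoPieces J i i' s x.1) (hd : 1 < d) {f : T.Space → ℝ} {C c δ : ℝ}
    (hb : T.BlockBound f c δ i') (hδ : 0 ≤ δ) (hf : ∀ x, |f x| ≤ C) (hc : |c| ≤ C) :
    |birkhoffSum (shiftMap T.subshift) f (T.tail J - s) ((shiftMap T.subshift)^[s] x) -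
      (T.tail J - s) * c| ≤ δ * (T.tail J - s) + 4 * C * T.len (J + d - 1) := by
  obtain ⟨t, ht⟩ := h.right
  have hC : 0 ≤ C := (abs_nonneg c).trans hc
  have h1 := hb.of_periodic hδ hf hc (T.tail J - s) ((shiftMap T.subshift)^[s] x) (t + s)
    fun k hk => by
      have := ht (s + k) (by omega) (by omega)
      rw [iterate_shiftMap_apply]
      rw [Nat.cast_add] at this
      rw [this, add_assoc]
  rw [Nat.cast_sub h.le_tail] at h1
  refine h1.trans ?_
  have : (T.len i' : ℝ) ≤ T.len (J + d - 1) := by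
    exact_mod_cast T.len_mono hd (by have := h.right_lt; omega)
  gcongr

lemma TwoPieces.abs_birkhoffSum_tail_le {J i i' s : ℕ} {x : T.Space}
    (h : T.TwoPieces J i i' s x.1) (hd : 1 < d) {f : T.Space → ℝ} {C c c' δ : ℝ}
    (hb : T.BlockBound f c δ i) (hb' : T.BlockBound f c' δ i') (hδ : 0 ≤ δ)
    (hf : ∀ x, |f x| ≤ C) (hc : |c| ≤ C) (hc' : |c'| ≤ C) :
    |birkhoffSum (shiftMap T.subshift) f (T.tail J) x - (s * c + (T.tail J - s) * c')| ≤
      δ * T.tail J + 8 * C * T.len (J + d - 1) := by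
  have h1 := h.abs_birkhoffSum_left_le hd hb hδ hf hc
  have h2 := h.abs_birkhoffSum_right_le hd hb' hδ hf hc'
  have h3 : birkhoffSum (shiftMap T.subshift) f (T.tail J) x =
      birkhoffSum (shiftMap T.subshift) f s x +
        birkhoffSum (shiftMap T.subshift) f (T.tail J - s) ((shiftMap T.subshift)^[s] x) := by
    rw [← birkhoffSum_add, Nat.add_sub_cancel' h.le_tail]
  rw [h3]
  rw [abs_le] at *
  constructor <;> linarith

variable (T)

lemma gap_mul_len_le_tail_div (J : ℕ) :
    (scaleGap d J : ℝ) * T.len (J + d - 1) ≤ T.tail J / scaleGap d J := by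
  have h1 := T.gap_sq_le_tail J
  have h2 : (0 : ℝ) < scaleGap d J := by exact_mod_cast scaleGap_pos (d := d) J
  rw [le_div_iff₀ h2]
  have h3 : (scaleGap d J : ℝ) ^ 2 * T.len (J + d - 1) ≤ T.tail J := by exact_mod_cast h1
  linarith

lemma len_le_tail_div (J : ℕ) : (T.len (J + d - 1) : ℝ) ≤ T.tail J / scaleGap d J := by
  refine le_trans ?_ (T.gap_mul_len_le_tail_div J)
  have h2 : (1 : ℝ) ≤ scaleGap d J := by exact_mod_cast one_le_gap (d := d) J
  exact le_mul_of_one_le_left (Nat.cast_nonneg _) h2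

lemma abs_birkhoffAverage_sub_le {Y : Type*} {σ : Y → Y} {f : Y → ℝ} {x : Y} {n : ℕ} {c δ : ℝ}
    (hn : 0 < n) (h : |birkhoffSum σ f n x - n * c| ≤ δ * n) :
    |birkhoffAverage ℝ σ f n x - c| ≤ δ := by
  have h2 : (0 : ℝ) < n := by exact_mod_cast hn
  have h3 : birkhoffAverage ℝ σ f n x - c = (birkhoffSum σ f n x - n * c) / n := by
    rw [birkhoffAverage, smul_eq_mul]
    field_simp
  rw [h3, abs_div, abs_of_pos h2]
  exact (div_le_iff₀ h2).2 h

/-- The integrals of `f` against the limit measures, indexed by the words. -/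
noncomputable def typeIntegral (hd : 1 < d) (f : T.Space → ℝ) (m : ℕ) : ℝ :=
  ∫ x, f x ∂(T.limitMeasure hd (Fin.ofNat d m))

lemma abs_typeIntegral_le (hd : 1 < d) {f : T.Space → ℝ} {C : ℝ} (hf : ∀ x, |f x| ≤ C) (m : ℕ) :
    |T.typeIntegral hd f m| ≤ C := by
  have := norm_integral_le_of_norm_le_const (μ := T.limitMeasure hd (Fin.ofNat d m))
    (Eventually.of_forall (p := fun x => ‖f x‖ ≤ C) hf)
  simpa [typeIntegral] using this

/-- Averages up to time `T.tail J` are close to convex combinations of at most two integrals. -/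
lemma eventually_abs_birkhoffAverage_tail_le (hd : 1 < d) {f : T.Space → ℝ} (hf : Continuous f)
    {ε : ℝ} (hε : 0 < ε) : ∀ᶠ J in atTop, ∀ (i i' s : ℕ) (x : T.Space), T.TwoPieces J i i' s x.1 →
      |birkhoffAverage ℝ (shiftMap T.subshift) f (T.tail J) x - (s / T.tail J *
        T.typeIntegral hd f i + (1 - s / T.tail J) * T.typeIntegral hd f i')| ≤ ε := by
  obtain ⟨C, hC, hfC⟩ := exists_abs_le hf
  obtain ⟨I, hI⟩ := T.eventually_blockBound hd hf (half_pos hε)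
  filter_upwards [eventually_ge_atTop I, (tendsto_div_scaleGap (d := d)
    (8 * C)).eventually_le_const (half_pos hε)] with J hJ hgap i i' s x h
  have h1 := h.abs_birkhoffSum_tail_le hd (hI i (hJ.trans h.left_ge))
    (hI i' (hJ.trans h.right_ge)) (half_pos hε).le hfC (T.abs_typeIntegral_le hd hfC i)
    (T.abs_typeIntegral_le hd hfC i')
  have h2 : (0 : ℝ) < T.tail J := by exact_mod_cast T.tail_pos J
  apply abs_birkhoffAverage_sub_le (T.tail_pos J)
  have h3 : (T.tail J : ℝ) * (s / T.tail J * T.typeIntegral hd f i +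
      (1 - s / T.tail J) * T.typeIntegral hd f i') =
      s * T.typeIntegral hd f i + (T.tail J - s) * T.typeIntegral hd f i' := by
    field_simp
  rw [h3]
  refine h1.trans ?_
  have h4 : 8 * C * (T.len (J + d - 1) : ℝ) ≤ 8 * C * (T.tail J / scaleGap d J) := by
    gcongr
    exact T.len_le_tail_div J
  have h5 : 8 * C * (T.tail J / scaleGap d J) = 8 * C / scaleGap d J * (T.tail J : ℝ) := by ring
  have h6 : 8 * C / scaleGap d J * (T.tail J : ℝ) ≤ ε / 2 * T.tail J := by gcongr
  linarith

lemma measurable_comp_window (g : List (Fin d) → ℝ) (n : ℕ) :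
    Measurable fun x : T.Space => g (window x.1 0 n) := by
  have h1 : Measurable fun u : Fin n → Fin d => g (List.ofFn u) := measurable_of_countable _
  have h2 : Measurable fun (x : T.Space) (k : Fin n) => x.1 (0 + k) :=
    measurable_pi_lambda _ fun k => (measurable_pi_apply _).comp measurable_subtype_coe
  exact h1.comp h2

lemma exists_convex_combination_limitMeasure (hd : 1 < d) (ν : Measure T.Space)
    [IsProbabilityMeasure ν] (hν : MeasurePreserving (shiftMap T.subshift) ν ν) :
    ∃ a ∈ stdSimplex ℝ (Fin d), ∀ f : T.Space → ℝ, Continuous f →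
      ∫ x, f x ∂ν = ∑ j, a j * ∫ x, f x ∂(T.limitMeasure hd j) := by
  choose i i' s h using T.exists_twoPieces_of_window hd
  have hp : ∀ J (x : T.Space), T.TwoPieces J (i J (window x.1 0 (T.tail J)))
      (i' J (window x.1 0 (T.tail J))) (s J (window x.1 0 (T.tail J))) x.1 :=
    fun J x => h J _ x.1 x.2 rfl
  -- The weight of a residue is the proportion of time spent in pieces of that type; the sum also
  -- covers the case where both pieces have the same type.
  set c : ℕ → List (Fin d) → Fin d → ℝ := fun J v j =>
    s J v / T.tail J * (if j = Fin.ofNat d (i J v) then 1 else 0) +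
      (1 - s J v / T.tail J) * (if j = Fin.ofNat d (i' J v) then 1 else 0) with hc
  refine exists_convex_combination (continuous_shiftMap T.subshift) T.tail T.tail_pos
    (fun J x => c J (window x.1 0 (T.tail J))) (fun J j =>
      T.measurable_comp_window (fun v => c J v j) _) (fun J x => ?_) (fun f hf ε hε => ?_) ν hν
  · have h1 : (0 : ℝ) < T.tail J := by exact_mod_cast T.tail_pos J
    have h2 : (s J (window x.1 0 (T.tail J)) : ℝ) / T.tail J ≤ 1 :=
      (div_le_one h1).2 (by exact_mod_cast (hp J x).le_tail)
    refine ⟨fun j => add_nonneg (mul_nonneg (by positivity) (by split_ifs <;> norm_num))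
      (mul_nonneg (by linarith) (by split_ifs <;> norm_num)), ?_⟩
    simp [hc, Finset.sum_add_distrib]
  · filter_upwards [T.eventually_abs_birkhoffAverage_tail_le hd hf hε] with J hJ x
    convert hJ _ _ _ x (hp J x) using 3
    simp [hc, add_mul, Finset.sum_add_distrib, typeIntegral]

/-- Two pieces could mix two measures at time `T.tail J`, but a generic point has the same limit
along every sequence of times, so the time may be chosen to see a single piece. -/
lemma eq_limitMeasure_of_isGenericPointFor (hd : 1 < d) {ν : Measure T.Space}
    [IsProbabilityMeasure ν] {x : T.Space} (hx : IsGenericPointFor (shiftMap T.subshift) ν x) :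
    ∃ i, ν = T.limitMeasure hd i := by
  have h : ∀ J, ∃ i i' s : ℕ, T.TwoPieces J i i' s x.1 := fun J => by
    obtain ⟨i, i', s, h⟩ := T.exists_twoPieces_of_window hd J (window x.1 0 (T.tail J))
    exact ⟨i, i', s, h x.1 x.2 rfl⟩
  choose i i' s h using h
  refine eq_of_isGenericPointFor (μ := T.limitMeasure hd) hx
    -- This threshold is large compared with the base words, so boundary effects in the first piece
    -- vanish, and small compared with the tail, which is at least `scaleGap ^ 2` times the longest
    -- base word. That is the reason for the square in `le_tail`.
    (fun J => if scaleGap d J * T.len (J + d - 1) ≤ s J then s J else T.tail J)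
    (fun J => if scaleGap d J * T.len (J + d - 1) ≤ s J then Fin.ofNat d (i J)
      else Fin.ofNat d (i' J)) ?_ fun f hf ε hε => ?_
  · refine tendsto_atTop_mono (fun J => ?_) tendsto_id
    dsimp only [id]
    split_ifs with hs
    · have h1 := le_scaleGap (d := d) J
      have h2 := Nat.le_mul_of_pos_right (scaleGap d J) (T.len_pos (J + d - 1))
      omega
    · exact T.le_tail_self J
  obtain ⟨C, hC, hfC⟩ := exists_abs_le hf
  obtain ⟨I, hI⟩ := T.eventually_blockBound hd hf (half_pos hε)
  filter_upwards [eventually_ge_atTop I, (tendsto_div_scaleGap (d := d)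
    (4 * C)).eventually_le_const (half_pos hε),
    T.eventually_abs_birkhoffAverage_tail_le hd hf (half_pos hε)] with J hJ hgap htail
  have hgp : (0 : ℝ) < scaleGap d J := by exact_mod_cast scaleGap_pos (d := d) J
  have hlp : (0 : ℝ) < T.len (J + d - 1) := by exact_mod_cast T.len_pos _
  have hCa := T.abs_typeIntegral_le hd hfC
  split_ifs with hs
  · have hs' : (scaleGap d J : ℝ) * T.len (J + d - 1) ≤ s J := by exact_mod_cast hs
    have hspos : 0 < s J := (Nat.mul_pos (scaleGap_pos J) (T.len_pos _)).trans_le hs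
    apply abs_birkhoffAverage_sub_le hspos
    refine ((h J).abs_birkhoffSum_left_le hd (hI (i J) (hJ.trans (h J).left_ge)) (half_pos hε).le
      hfC (hCa (i J))).trans ?_
    have h1 : 4 * C * (T.len (J + d - 1) : ℝ) ≤ 4 * C / scaleGap d J * s J := by
      rw [div_mul_eq_mul_div, le_div_iff₀ hgp]
      calc 4 * C * (T.len (J + d - 1) : ℝ) * scaleGap d J
          = 4 * C * (scaleGap d J * T.len (J + d - 1)) := by ring
        _ ≤ _ := by gcongr
    have h2 : 4 * C / scaleGap d J * (s J : ℝ) ≤ ε / 2 * s J := by gcongr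
    linarith
  · have h1 := htail _ _ _ x (h J)
    have hL : (0 : ℝ) < T.tail J := by exact_mod_cast T.tail_pos J
    have h2 : (s J : ℝ) / T.tail J ≤ 1 / scaleGap d J := by
      rw [div_le_iff₀ hL]
      have h3 : (s J : ℝ) ≤ scaleGap d J * T.len (J + d - 1) := by
        exact_mod_cast (not_le.1 hs).le
      exact (h3.trans (T.gap_mul_len_le_tail_div J)).trans_eq (by ring)
    have h3 : |(s J : ℝ) / T.tail J *
        (T.typeIntegral hd f (i J) - T.typeIntegral hd f (i' J))| ≤ ε / 2 := by
      rw [abs_mul, abs_of_nonneg (by positivity)]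
      have h4 : |T.typeIntegral hd f (i J) - T.typeIntegral hd f (i' J)| ≤ 4 * C := by
        have h5 := hCa (i J)
        have h6 := hCa (i' J)
        rw [abs_le] at *
        constructor <;> linarith
      calc (s J : ℝ) / T.tail J * |T.typeIntegral hd f (i J) - T.typeIntegral hd f (i' J)|
          ≤ 1 / scaleGap d J * (4 * C) := by gcongr
        _ = 4 * C / scaleGap d J := by ring
        _ ≤ _ := hgap
    change |_ - T.typeIntegral hd f (i' J)| ≤ ε
    rw [abs_le] at *
    constructor <;> linarith

lemma ergodic_iff_eq_limitMeasure (hd : 1 < d) (ν : Measure T.Space) :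
    (IsProbabilityMeasure ν ∧ Ergodic (shiftMap T.subshift) ν) ↔
      ∃ i, ν = T.limitMeasure hd i := by
  refine ergodic_iff_exists_eq (T.measurePreserving_limitMeasure hd)
    (fun ν hp hν => T.exists_convex_combination_limitMeasure hd ν hν)
    T.letterIndicator T.continuous_letterIndicator (fun i => ?_) (fun i j hij => ?_) ν
  · have := T.abs_integral_letterIndicator_sub_le hd i i
    rw [if_pos rfl, abs_le] at this
    linarith
  · have := T.abs_integral_letterIndicator_sub_le hd i j
    rw [if_neg hij, abs_le] at this
    linarith

lemma limitMeasure_injective (hd : 1 < d) : Function.Injective (T.limitMeasure hd) := by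
  intro i j hij
  by_contra hne
  have h1 := T.abs_integral_letterIndicator_sub_le hd i i
  have h2 := T.abs_integral_letterIndicator_sub_le hd i j
  rw [if_pos rfl, hij, abs_le] at h1
  rw [if_neg (Ne.symm hne), abs_le] at h2
  linarith

end WordTower

/-- The alphabet is `Fin k` with the discrete topology, and measures live on the Borel σ-algebra
of the subspace `X` of `ℤ → Fin k`. The limits are taken in the extended reals, so that no
boundedness is presupposed. -/
theorem theorem1p3 (d : ℕ) (hd : 1 < d) :
    ∃ (k : ℕ) (X : Subshift (Fin k) ℤ),
      IsMinimalSubshift X ∧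
      {μ : Measure X.carrier | IsProbabilityMeasure μ ∧ Ergodic (shiftMap X) μ}.encard = d ∧
      (∀ μ : Measure X.carrier, IsGenericMeasure (shiftMap X) μ → Ergodic (shiftMap X) μ) ∧
      liminf (fun n : ℕ => (((complexityFn X n : ℝ) / (n : ℝ) : ℝ) : EReal)) atTop
        = ((d : ℝ) : EReal) ∧
      limsup (fun n : ℕ => (((complexityFn X n : ℝ) / (n : ℝ) : ℝ) : EReal)) atTop
        = (((d : ℝ) + 1 : ℝ) : EReal) := by
  have : NeZero d := ⟨by omega⟩
  let T := WordTower.standard d hd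
  refine ⟨d, T.subshift, T.isMinimalSubshift hd, ?_, ?_, T.liminf_complexityFn hd,
    T.limsup_complexityFn hd⟩
  · have h : {μ : Measure T.Space | IsProbabilityMeasure μ ∧ Ergodic (shiftMap T.subshift) μ} =
        T.limitMeasure hd '' Set.univ := by
      ext ν
      rw [Set.image_univ]
      exact (T.ergodic_iff_eq_limitMeasure hd ν).trans (exists_congr fun i => eq_comm)
    rw [h, (T.limitMeasure_injective hd).encard_image]
    simp
  · rintro μ ⟨hprob, -, x, hx⟩
    obtain ⟨i, rfl⟩ := T.eq_limitMeasure_of_isGenericPointFor hd hx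
    exact ((T.ergodic_iff_eq_limitMeasure hd _).2 ⟨i, rfl⟩).2
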